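/- Let $G$ be a finite simple undirected graph with vertex set $V$. For a real symmetric $V\times V$ matrix $S$, consider the complex symmetric $V\times V$ matrices $\Sigma$ such that $\Sigma_{ij}=S_{ij}$ whenever $i=j$ or $\{i,j\}$ is an edge of $G$, and such that $\Sigma$ is invertible with $(\Sigma^{-1})_{ij}=0$ whenever $i\ne j$ and $\{i,j\}$ is not an edge of $G$. The ML degree of the Gaussian graphical model of $G$ is the number of such matrices $\Sigma$ for generic $S$, that is, for all $S$ in some nonempty Zariski open subset of the space of real symmetric $V\times V$ matrices. The graph $G$ is chordal if every cycle of length at least four in $G$ has a chord, i.e. an edge of $G$ that joins two vertices of the cycle but is not an edge of the cycle. **Theorem 4.3.** The graph $G$ is chordal if and only if the Gaussian graphical model of $G$ has ML degree $1$. -/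

import Mathlib

/-- A graph is chordal if every cycle of length at least four has a chord. -/
def SimpleGraph.IsChordalGraph {V : Type*} (G : SimpleGraph V) : Prop :=
  ∀ (v : V) (c : G.Walk v v), c.IsCycle → 4 ≤ c.length → ¬ c.IsChordless

/-- The complexified linear space `L_G` of the Gaussian graphical model of `G`: the symmetric
matrices whose off-diagonal entries vanish at the non-edges of `G`. -/
def concentrationSpace {V : Type*} (G : SimpleGraph V) : Submodule ℂ (Matrix V V ℂ) where
  carrier := {K | K.IsSymm ∧ ∀ i j, i ≠ j → ¬ G.Adj i j → K i j = 0}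
  add_mem' := by
    rintro A B ⟨hA, hA'⟩ ⟨hB, hB'⟩
    refine ⟨hA.add hB, fun i j hij h => ?_⟩
    simp [hA' i j hij h, hB' i j hij h]
  zero_mem' := ⟨Matrix.isSymm_zero, fun _ _ _ _ => rfl⟩
  smul_mem' := by
    rintro a A ⟨hA, hA'⟩
    refine ⟨hA.smul a, fun i j hij h => ?_⟩
    simp [hA' i j hij h]

/-- The complex solutions `Σ` of the likelihood equations of the Gaussian graphical model of `G`
for the real symmetric data matrix `S`: `Σ` is symmetric, agrees with `S` on the diagonal and at
the edges of `G` (that is, `Σ - S` is orthogonal to `L_G`), and is invertible with inverse in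
`L_G`. -/
def likelihoodSolutions {V : Type*} [Fintype V] [DecidableEq V] (G : SimpleGraph V)
    (S : Matrix V V ℝ) : Set (Matrix V V ℂ) :=
  {T | T.IsSymm ∧ (∀ i j, (i = j ∨ G.Adj i j) → T i j = (S i j : ℂ)) ∧
    ∃ K ∈ concentrationSpace G, T * K = 1}

/-- The Gaussian graphical model of `G` has ML degree `n`: for generic real symmetric `S`
(all `S` in some nonempty Zariski open subset of the space of real symmetric matrices, described
by the nonvanishing of a polynomial in the entries) the likelihood equations have exactly `n`
complex solutions. -/
def HasMLDegree {V : Type*} [Fintype V] [DecidableEq V] (G : SimpleGraph V) (n : ℕ) : Prop :=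
  ∃ p : MvPolynomial (V × V) ℝ,
    (∃ S : Matrix V V ℝ, S.IsSymm ∧ MvPolynomial.eval (fun e => S e.1 e.2) p ≠ 0) ∧
    ∀ S : Matrix V V ℝ, S.IsSymm → MvPolynomial.eval (fun e => S e.1 e.2) p ≠ 0 →
      (likelihoodSolutions G S).encard = n

/-- A graph has at most one ML degree. -/
theorem HasMLDegree.unique {V : Type*} [Fintype V] [DecidableEq V] {G : SimpleGraph V}
    {m n : ℕ} (hm : HasMLDegree G m) (hn : HasMLDegree G n) : m = n := by
  obtain ⟨p, ⟨S, hS, hpS⟩, hp⟩ := hm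
  obtain ⟨q, ⟨T, hT, hqT⟩, hq⟩ := hn
  -- polynomials in the upper triangular entries
  let r : V × V → Sym2 V := fun e => s(e.1, e.2)
  have key : ∀ (A : Matrix V V ℝ), A.IsSymm → ∃ a : Sym2 V → ℝ, ∀ e : V × V,
      a (r e) = A e.1 e.2 := fun A hA =>
    ⟨Sym2.lift ⟨fun i j => A i j, fun i j => hA.apply j i⟩, fun e => rfl⟩
  have ne : ∀ (f : MvPolynomial (V × V) ℝ) (A : Matrix V V ℝ), A.IsSymm →
      MvPolynomial.eval (fun e => A e.1 e.2) f ≠ 0 → MvPolynomial.rename r f ≠ 0 := by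
    intro f A hA hf h
    obtain ⟨a, ha⟩ := key A hA
    apply hf
    have : MvPolynomial.eval a (MvPolynomial.rename r f) = 0 := by rw [h]; simp
    rw [MvPolynomial.eval_rename] at this
    rw [← this]
    congr 2
    funext e
    exact (ha e).symm
  have hpq := mul_ne_zero (ne p S hS hpS) (ne q T hT hqT)
  obtain ⟨a, ha⟩ : ∃ a, MvPolynomial.eval a
      (MvPolynomial.rename r p * MvPolynomial.rename r q) ≠ 0 := by
    by_contra! h
    exact hpq (MvPolynomial.funext (by simpa using h))
  rw [map_mul, MvPolynomial.eval_rename, MvPolynomial.eval_rename] at ha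
  let A : Matrix V V ℝ := Matrix.of fun i j => a s(i, j)
  have hA : A.IsSymm := by
    ext i j
    simp [A, Sym2.eq_swap]
  have h1 := hp A hA (left_ne_zero_of_mul ha)
  have h2 := hq A hA (right_ne_zero_of_mul ha)
  exact_mod_cast h1.symm.trans h2

/-! # Chordal graphs and maximum likelihood degree one

*Chordal graphs have ML degree one.* By Dirac's theorem a chordal graph can be dismantled by
removing, one after the other, vertices `v` that are simplicial in what is left. Let `N` be the
clique of neighbours of `v`. For a solution `T` with inverse `K`, the column of `v` in `K` is
supported on `N ∪ {v}` and solves a linear system whose coefficients are data, so it is determined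
up to a factor. The congruence of `T` by the corresponding shear isolates `v`, and this is a
bijection from the solutions to those of a likelihood problem for the graph without the edges at
`v` (`completions_eq_singleton_of_isolate`). By induction there is exactly one solution whenever
all principal minors of the data are nonzero.

*Other graphs have a larger ML degree.* If some data have two distinct solutions at which the
differential of `K ↦ K⁻¹`, restricted to the diagonal and the edges, is injective, then by the
inverse function theorem all nearby data have two solutions, and nearby data can be chosen generic
(`not_hasMLDegree_one_of_nondegenerate`). To find two solutions, take a real solution `T` that
vanishes at all edges between a set `B` of vertices and its complement, while `K = T⁻¹` does not
vanish between them. Changing the signs of the rows and columns in `B` preserves the data and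
changes the solution. Such a `CutCertificate` is written down for the four-cycle. It passes to
subdivisions of an edge on one side of the cut (`CutCertificate.subdivide`), hence exists for all
longer cycles, and from an induced subgraph to the whole graph (`CutCertificate.extend`): the new
vertices get a block equal to the identity, which is nondegenerate because all principal minors
of `T` are nonzero. A graph that is not chordal contains an induced cycle of length at least four.
-/

/-! ### Simplicial vertices of chordal graphs -/

namespace SimpleGraph

variable {V : Type*} {G : SimpleGraph V}

/-- The vertex `x` belongs to `U`, and its neighbours in `U` are pairwise adjacent. -/
def IsSimplicialIn (G : SimpleGraph V) (U : Set V) (x : V) : Prop :=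
  x ∈ U ∧ ∀ a ∈ U, ∀ b ∈ U, G.Adj x a → G.Adj x b → a ≠ b → G.Adj a b

/-- A walk of minimal length among the walks with the same ends whose vertices satisfy `P` is a
chordless path. -/
theorem exists_chordless_path_of_walk {a b : V} (P : V → Prop) (w : G.Walk a b)
    (hw : ∀ x ∈ w.support, P x) :
    ∃ p : G.Walk a b, p.IsPath ∧ p.IsChordless ∧ ∀ x ∈ p.support, P x := by
  classical
  have hex : ∃ n, ∃ p : G.Walk a b, p.length = n ∧ ∀ x ∈ p.support, P x := ⟨_, w, rfl, hw⟩
  obtain ⟨p, hpl, hpP⟩ := Nat.find_spec hex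
  have hmin : ∀ q : G.Walk a b, (∀ x ∈ q.support, P x) → p.length ≤ q.length := by
    intro q hq
    rw [hpl]
    exact Nat.find_min' hex ⟨q, rfl, hq⟩
  have hbP : ∀ x ∈ p.bypass.support, P x := fun x hx => hpP x (p.support_bypass_subset_support hx)
  have hmin' : ∀ q : G.Walk a b, (∀ x ∈ q.support, P x) → p.bypass.length ≤ q.length :=
    fun q hq => p.length_bypass_le_length.trans (hmin q hq)
  refine ⟨p.bypass, p.bypass_isPath, ?_, hbP⟩
  generalize p.bypass = r at hbP hmin'
  -- a chord would give a shortcut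
  have short : ∀ i j, i < j → j ≤ r.length → G.Adj (r.getVert i) (r.getVert j) → j = i + 1 := by
    intro i j hij hj hadj
    have hlen := hmin' ((r.take i).append (Walk.cons hadj (r.drop j))) (by
      intro x hx
      rw [Walk.mem_support_append_iff, Walk.support_cons, List.mem_cons] at hx
      rcases hx with hx | rfl | hx
      · exact hbP x ((r.isSubwalk_take _).support_subset hx)
      · exact hbP _ (r.getVert_mem_support _)
      · exact hbP x ((r.isSubwalk_drop _).support_subset hx))
    rw [Walk.length_append, Walk.length_cons, Walk.take_length, Walk.drop_length] at hlen
    omega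
  rw [Walk.isChordless_iff_forall_mem_edges]
  intro x y hx hy hxy
  rw [Walk.mem_support_iff_exists_getVert] at hx hy
  obtain ⟨i, rfl, hi⟩ := hx
  obtain ⟨j, rfl, hj⟩ := hy
  rw [Walk.mk_mem_edges_iff_exists]
  rcases lt_trichotomy i j with h | h | h
  · obtain rfl := short i j h hj hxy
    exact ⟨i, by omega, rfl⟩
  · subst h
    exact absurd hxy (G.irrefl)
  · obtain rfl := short j i h hi hxy.symm
    exact ⟨j, by omega, Sym2.eq_swap⟩

/-- Two neighbours `a`, `b` of `v` that are joined by a walk avoiding `v` and its other neighbours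
are adjacent in a chordal graph: a shortest such walk closes up through `v` to a chordless
cycle. -/
theorem IsChordalGraph.adj_of_walk (hG : G.IsChordalGraph) {v a b : V} (hva : G.Adj v a)
    (hvb : G.Adj v b) (hab : a ≠ b) (w : G.Walk a b)
    (hw : ∀ x ∈ w.support, x = a ∨ x = b ∨ (x ≠ v ∧ ¬ G.Adj v x)) : G.Adj a b := by
  by_contra hnab
  obtain ⟨p, hp, hc, hP⟩ := exists_chordless_path_of_walk _ w hw
  have hv : v ∉ p.support := by
    intro h
    rcases hP v h with rfl | rfl | h
    · exact G.irrefl hva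
    · exact G.irrefl hvb
    · exact h.1 rfl
  have hlen : 2 ≤ p.length := by
    by_contra! h
    rcases Nat.lt_succ_iff.1 h |>.eq_or_lt with h | h
    · exact hnab (Walk.adj_of_length_eq_one h)
    · exact hab (p.eq_of_length_eq_zero (by omega))
  have hedge : s(v, a) ∉ (p.concat hvb.symm).edges := by
    rw [Walk.edges_concat, List.concat_eq_append, List.mem_append, List.mem_singleton]
    rintro (h | h)
    · exact hv (p.fst_mem_support_of_mem_edges h)
    · rw [Sym2.eq_iff] at h
      rcases h with ⟨rfl, -⟩ | ⟨-, h⟩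
      · exact G.irrefl hvb
      · exact hab h
  refine hG v (Walk.cons hva (p.concat hvb.symm))
    ((Walk.cons_isCycle_iff _ _).2 ⟨hp.concat hv hvb.symm, hedge⟩) (by
    rw [Walk.length_cons, Walk.length_concat]; omega) ?_
  rw [Walk.isChordless_iff_forall_mem_edges] at hc ⊢
  have key : ∀ y ∈ p.support, G.Adj v y →
      s(v, y) ∈ (Walk.cons hva (p.concat hvb.symm)).edges := by
    intro y hy hvy
    rw [Walk.edges_cons, Walk.edges_concat]
    rcases hP y hy with rfl | rfl | h
    · simp
    · simp [Sym2.eq_swap]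
    · exact absurd hvy h.2
  intro x y hx hy hxy
  have hx' : x = v ∨ x ∈ p.support := by
    simpa [Walk.support_concat, or_comm, or_assoc] using hx
  have hy' : y = v ∨ y ∈ p.support := by
    simpa [Walk.support_concat, or_comm, or_assoc] using hy
  rcases hx' with rfl | hx' <;> rcases hy' with rfl | hy'
  · exact absurd hxy G.irrefl
  · exact key y hy' hxy
  · rw [Sym2.eq_swap]
    exact key x hx' hxy.symm
  · rw [Walk.edges_cons, Walk.edges_concat]
    simp [hc hx' hy' hxy]

/-- Among the vertices of `U` that are not adjacent to a given vertex `v` there is one that is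
simplicial in `U`, provided that there are such vertices at all. In a component `C` of these
vertices, the neighbours `S` of `C` form a clique by chordality, and induction applies to
`C ∪ S`. -/
theorem IsChordalGraph.exists_isSimplicialIn_not_adj (hG : G.IsChordalGraph) :
    ∀ (n : ℕ) (U : Finset V), U.card = n → ∀ v ∈ U, ∀ w ∈ U, w ≠ v → ¬ G.Adj v w →
      ∃ x, G.IsSimplicialIn U x ∧ x ≠ v ∧ ¬ G.Adj v x := by
  classical
  intro n
  induction n using Nat.strong_induction_on with
  | _ n ih =>
  intro U hU v hv w hw hwv hvw
  let D : Set V := {x | x ∈ U ∧ x ≠ v ∧ ¬ G.Adj v x}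
  let C : Set V := {c | ∃ p : G.Walk w c, ∀ x ∈ p.support, x ∈ D}
  let S : Set V := {s | s ∈ U ∧ s ∉ D ∧ ∃ c ∈ C, G.Adj c s}
  have hCD : C ⊆ D := fun c ⟨p, hp⟩ => hp c p.end_mem_support
  have hwC : w ∈ C := ⟨Walk.nil, by simp [D, hw, hwv, hvw]⟩
  have hSv : ∀ s ∈ S, G.Adj v s := by
    rintro s ⟨hsU, hsD, c, hc, hcs⟩
    by_contra h
    refine hsD ⟨hsU, ?_, h⟩
    rintro rfl
    exact (hCD hc).2.2 hcs.symm
  have hSclique : ∀ a ∈ S, ∀ b ∈ S, a ≠ b → G.Adj a b := by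
    intro a ha b hb hab
    obtain ⟨-, -, c, ⟨p, hp⟩, hca⟩ := id ha
    obtain ⟨-, -, d, ⟨q, hq⟩, hdb⟩ := id hb
    refine hG.adj_of_walk (hSv a ha) (hSv b hb) hab
      (Walk.cons hca.symm ((p.reverse.append q).concat hdb)) ?_
    intro x hx
    simp only [Walk.support_cons, Walk.support_concat, List.mem_cons, List.mem_append,
      List.not_mem_nil, or_false, Walk.mem_support_append_iff, Walk.support_reverse,
      List.mem_reverse] at hx
    rcases hx with hx | (hx | hx) | hx
    · exact Or.inl hx
    · exact Or.inr (Or.inr (hp x hx).2)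
    · exact Or.inr (Or.inr (hq x hx).2)
    · exact Or.inr (Or.inl hx)
  have hnbr : ∀ c ∈ C, ∀ y ∈ U, G.Adj c y → y ∈ C ∨ y ∈ S := by
    rintro c hc y hy hcy
    by_cases hyD : y ∈ D
    · obtain ⟨p, hp⟩ := hc
      refine Or.inl ⟨p.concat hcy, fun x hx => ?_⟩
      simp only [Walk.support_concat, List.mem_append, List.mem_singleton] at hx
      rcases hx with hx | rfl
      · exact hp x hx
      · exact hyD
    · exact Or.inr ⟨hy, hyD, c, hc, hcy⟩
  let U' := U.filter fun x => x ∈ C ∨ x ∈ S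
  have hU' : ∀ x, x ∈ U' ↔ x ∈ C ∨ x ∈ S := by
    intro x
    simp only [U', Finset.mem_filter, and_iff_right_iff_imp]
    rintro (h | h)
    · exact (hCD h).1
    · exact h.1
  have hcard : U'.card < n := by
    rw [← hU]
    refine Finset.card_lt_card ((Finset.ssubset_iff_of_subset (Finset.filter_subset _ _)).2
      ⟨v, hv, ?_⟩)
    rw [hU']
    rintro (h | h)
    · exact (hCD h).2.1 rfl
    · exact G.irrefl (hSv v h)
  -- a simplicial vertex of `C ∪ S` in `C` is simplicial in `U`
  have lift : ∀ x ∈ C, G.IsSimplicialIn U' x → ∃ x, G.IsSimplicialIn U x ∧ x ≠ v ∧ ¬ G.Adj v x := by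
    intro x hx hs
    refine ⟨x, ⟨(hCD hx).1, fun a ha b hb hxa hxb hab => ?_⟩, (hCD hx).2⟩
    exact hs.2 a ((hU' a).2 (hnbr x hx a ha hxa)) b ((hU' b).2 (hnbr x hx b hb hxb)) hxa hxb hab
  by_cases h1 : ∃ s ∈ S, ∃ z ∈ U', z ≠ s ∧ ¬ G.Adj s z
  · obtain ⟨s, hs, z, hz, hzs, hsz⟩ := h1
    obtain ⟨x, hx, hxs, hsx⟩ := ih _ hcard U' rfl s ((hU' s).2 (Or.inr hs)) z hz hzs hsz
    rcases (hU' x).1 hx.1 with hxC | hxS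
    · exact lift x hxC hx
    · exact absurd (hSclique s hs x hxS hxs.symm) hsx
  by_cases h2 : ∃ c ∈ C, ∃ z ∈ U', z ≠ c ∧ ¬ G.Adj c z
  · obtain ⟨c, hc, z, hz, hzc, hcz⟩ := h2
    have hcU' := (hU' c).2 (Or.inl hc)
    obtain ⟨x, hx, hxc, hcx⟩ := ih _ hcard U' rfl c hcU' z hz hzc hcz
    rcases (hU' x).1 hx.1 with hxC | hxS
    · exact lift x hxC hx
    · exact absurd ⟨x, hxS, c, hcU', hxc.symm, fun h => hcx h.symm⟩ h1
  · push Not at h1 h2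
    refine lift w hwC ⟨(hU' w).2 (Or.inl hwC), fun a ha b hb _ _ hab => ?_⟩
    rcases (hU' a).1 ha with h | h
    · exact h2 a h b hb hab.symm
    · exact h1 a h b hb hab.symm

/-- Dirac's theorem: every nonempty set of vertices of a chordal graph contains a vertex that is
simplicial in the set. -/
theorem IsChordalGraph.exists_isSimplicialIn (hG : G.IsChordalGraph) {U : Finset V}
    (hU : U.Nonempty) : ∃ x, G.IsSimplicialIn U x := by
  by_cases h : ∃ v ∈ U, ∃ w ∈ U, w ≠ v ∧ ¬ G.Adj v w
  · obtain ⟨v, hv, w, hw, hwv, hvw⟩ := h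
    obtain ⟨x, hx, -⟩ := hG.exists_isSimplicialIn_not_adj _ U rfl v hv w hw hwv hvw
    exact ⟨x, hx⟩
  · push Not at h
    obtain ⟨x, hx⟩ := hU
    exact ⟨x, hx, fun a ha b hb _ _ hab => h a ha b hb hab.symm⟩

end SimpleGraph

/-! ### Principal submatrices and shears -/

namespace Matrix

theorem IsSymm.congr {V R : Type*} [Fintype V] [CommRing R] {T : Matrix V V R} (hT : T.IsSymm)
    (Q : Matrix V V R) : (Q * T * Qᵀ).IsSymm := by
  rw [IsSymm, transpose_mul, transpose_mul, transpose_transpose, hT.eq, Matrix.mul_assoc]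

theorem IsSymm.vecMul_eq {V R : Type*} [Fintype V] [CommRing R] {T : Matrix V V R} (hT : T.IsSymm)
    (x : V → R) : x ᵥ* T = T *ᵥ x := by
  rw [← vecMul_transpose, hT.eq]

variable {V K : Type*} [Fintype V] [DecidableEq V] [Field K]

/-- The principal submatrix of `A` with rows and columns in `s` is nonsingular, expressed by
vectors supported on `s`. -/
def NonsingularOn (A : Matrix V V K) (s : Set V) : Prop :=
  ∀ x : V → K, (∀ i ∉ s, x i = 0) → (∀ i ∈ s, (A *ᵥ x) i = 0) → x = 0

/-- The matrix with the rows and columns in `s` of `A`, and those of the identity elsewhere. -/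
def mask (R : Type*) [Zero R] [One R] (A : Matrix V V R) (s : Finset V) : Matrix V V R :=
  of fun i j => if i ∈ s ∧ j ∈ s then A i j else if i = j then 1 else 0

theorem nonsingularOn_of_det_mask_ne_zero {A : Matrix V V K} {s : Finset V}
    (h : (mask K A s).det ≠ 0) : A.NonsingularOn s := by
  intro x hx hA
  refine Matrix.eq_zero_of_mulVec_eq_zero h (funext fun i => ?_)
  by_cases hi : i ∈ s
  · rw [Pi.zero_apply, ← hA i hi]
    refine Finset.sum_congr rfl fun j _ => ?_
    by_cases hj : j ∈ s
    · simp [mask, hi, hj]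
    · simp [hx j hj]
  · simp [mulVec, dotProduct, mask, hi, hx i (by simpa using hi)]

/-- A nonsingular principal subsystem of linear equations can be solved. -/
theorem NonsingularOn.exists_solution {A : Matrix V V K} {s : Set V} (h : A.NonsingularOn s)
    (b : V → K) : ∃ u : V → K, (∀ i ∉ s, u i = 0) ∧ ∀ i ∈ s, (A *ᵥ u) i = b i := by
  classical
  let M : Matrix V V K := of fun i j => if i ∈ s then A i j else (1 : Matrix V V K) i j
  have hM : ∀ x i, (M *ᵥ x) i = if i ∈ s then (A *ᵥ x) i else x i := by
    intro x i
    by_cases hi : i ∈ s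
    · simp [M, mulVec, hi]
    · have : (M *ᵥ x) i = ((1 : Matrix V V K) *ᵥ x) i := by simp [M, mulVec, dotProduct, hi]
      rw [this, one_mulVec, if_neg hi]
  have hinj : Function.Injective M.mulVecLin := by
    rw [← LinearMap.ker_eq_bot, LinearMap.ker_eq_bot']
    intro x hx
    refine h x (fun i hi => ?_) fun i hi => ?_
    · simpa [hM, hi] using congrFun hx i
    · simpa [hM, hi] using congrFun hx i
  obtain ⟨u, hu⟩ := LinearMap.surjective_of_injective hinj fun i => if i ∈ s then b i else 0
  refine ⟨u, fun i hi => ?_, fun i hi => ?_⟩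
  · simpa [hM, hi] using congrFun hu i
  · simpa [hM, hi] using congrFun hu i

/-- The elementary matrix that adds to row `v` the combination of all rows with coefficients
`u`. -/
def shear {R : Type*} [CommRing R] (v : V) (u : V → R) : Matrix V V R :=
  1 + vecMulVec (Pi.single v 1) u

section Shear

variable {R : Type*} [CommRing R] (v : V) (u : V → R) (M : Matrix V V R) (i j : V)

theorem shear_mul_apply : (shear v u * M) i j = M i j + if i = v then (u ᵥ* M) j else 0 := by
  rw [shear, add_mul, one_mul, add_apply, vecMulVec_mul, vecMulVec_apply]
  by_cases h : i = v <;> simp [h]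

theorem mul_shear_transpose_apply :
    (M * (shear v u)ᵀ) i j = M i j + if j = v then (M *ᵥ u) i else 0 := by
  rw [← transpose_apply (M * _), transpose_mul, transpose_transpose, shear_mul_apply,
    vecMul_transpose, transpose_apply]

theorem mul_shear_apply : (M * shear v u) i j = M i j + M i v * u j := by
  rw [shear, mul_add, mul_one, add_apply, mul_vecMulVec, vecMulVec_apply]
  simp

theorem shear_transpose_mul_apply : ((shear v u)ᵀ * M) i j = M i j + u i * M v j := by
  rw [← transpose_apply ((shear v u)ᵀ * M), transpose_mul, transpose_transpose, mul_shear_apply,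
    transpose_apply, transpose_apply, mul_comm]

theorem shear_mulVec_apply (x : V → R) :
    (shear v u *ᵥ x) i = x i + if i = v then u ⬝ᵥ x else 0 := by
  rw [shear, add_mulVec, one_mulVec, Pi.add_apply, vecMulVec_mulVec]
  by_cases h : i = v <;> simp [h]

theorem shear_transpose_mulVec_apply (x : V → R) :
    ((shear v u)ᵀ *ᵥ x) i = x i + u i * x v := by
  rw [shear, transpose_add, transpose_one, add_mulVec, one_mulVec, Pi.add_apply,
    transpose_vecMulVec, vecMulVec_mulVec]
  simp

variable {v u}

theorem shear_mul_shear_neg (h : u v = 0) : shear v u * shear v (-u) = 1 := by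
  ext i j
  rw [mul_shear_apply]
  rcases eq_or_ne i v with rfl | hi
  · simp [shear, vecMulVec_apply, h]
  · simp [shear, vecMulVec_apply, hi]

theorem shear_neg_mul_shear (h : u v = 0) : shear v (-u) * shear v u = 1 := by
  simpa using shear_mul_shear_neg (v := v) (u := -u) (by simpa using h)

end Shear

/-- Congruent changes of a matrix and of its inverse. -/
theorem shear_congr_mul_eq_one {R : Type*} [CommRing R] {v : V} {u : V → R} (h : u v = 0)
    {T L : Matrix V V R} (hTL : T * L = 1) :
    (shear v (-u) * T * (shear v (-u))ᵀ) * ((shear v u)ᵀ * L * shear v u) = 1 := by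
  have h1 : (shear v (-u))ᵀ * (shear v u)ᵀ = 1 := by
    rw [← transpose_mul, shear_mul_shear_neg h, transpose_one]
  calc _ = shear v (-u) * T * ((shear v (-u))ᵀ * (shear v u)ᵀ) * L * shear v u := by
        simp only [Matrix.mul_assoc]
    _ = shear v (-u) * (T * L) * shear v u := by rw [h1]; simp only [Matrix.mul_assoc, one_mul]
    _ = 1 := by rw [hTL, mul_one, shear_neg_mul_shear h]

/-- The entries of a symmetric matrix after the congruence by a shear. -/
theorem shear_congr_apply {R : Type*} [CommRing R] {T : Matrix V V R} (hT : T.IsSymm) (v : V)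
    (u : V → R) (i j : V) : (shear v u * T * (shear v u)ᵀ) i j =
      T i j + (if i = v then (T *ᵥ u) j else 0) + (if j = v then (T *ᵥ u) i else 0) +
        (if i = v ∧ j = v then u ⬝ᵥ (T *ᵥ u) else 0) := by
  rw [mul_shear_transpose_apply, shear_mul_apply, ← mulVec_mulVec, shear_mulVec_apply,
    hT.vecMul_eq]
  by_cases hi : i = v <;> by_cases hj : j = v <;> simp [hi, hj]
  ring

/-- The entries of a symmetric matrix after the congruence by a transposed shear. -/
theorem shear_transpose_congr_apply {R : Type*} [CommRing R] (L : Matrix V V R) (v : V)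
    (u : V → R) (i j : V) : ((shear v u)ᵀ * L * shear v u) i j =
      L i j + u i * L v j + L i v * u j + u i * u j * L v v := by
  rw [mul_shear_apply, shear_transpose_mul_apply, shear_transpose_mul_apply]
  ring

end Matrix

/-! ### Eliminating simplicial vertices -/

open Matrix

section Elimination

variable {V : Type*}

/-- The subgraph of `G` with all the vertices of `G` and the edges of `G` inside `U`. -/
def SimpleGraph.inside (G : SimpleGraph V) (U : Set V) : SimpleGraph V where
  Adj i j := i ∈ U ∧ j ∈ U ∧ G.Adj i j
  symm := ⟨fun _ _ h => ⟨h.2.1, h.1, h.2.2.symm⟩⟩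
  loopless := ⟨fun _ h => G.irrefl h.2.2⟩

variable [Fintype V] [DecidableEq V]

/-- The complex solutions of the likelihood equations, for complex data. -/
def completions (H : SimpleGraph V) (S : Matrix V V ℂ) : Set (Matrix V V ℂ) :=
  {T | T.IsSymm ∧ (∀ i j, (i = j ∨ H.Adj i j) → T i j = S i j) ∧
    ∃ K ∈ concentrationSpace H, T * K = 1}

/-- The principal submatrices of the data at the cliques of `H` are nonsingular. -/
def RegularOnCliques (H : SimpleGraph V) (S : Matrix V V ℂ) : Prop :=
  ∀ s : Set V, H.IsClique s → S.NonsingularOn s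

/-- Without edges the solution is the diagonal of the data. -/
theorem completions_of_forall_not_adj {H : SimpleGraph V} (hH : ∀ i j, ¬ H.Adj i j)
    {S : Matrix V V ℂ} (hS : RegularOnCliques H S) :
    completions H S = {diagonal fun i => S i i} := by
  have hne : ∀ i, S i i ≠ 0 := by
    intro i hi
    have := hS {i} (by simp) (Pi.single i 1) (fun j hj => Pi.single_eq_of_ne hj 1)
      (by simpa using hi)
    simpa using congrFun this i
  ext T
  rw [Set.mem_singleton_iff]
  constructor
  · rintro ⟨hT, hTS, K, ⟨hK, hK0⟩, hTK⟩
    have hKd : K = diagonal fun i => K i i := by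
      ext i j
      rcases eq_or_ne i j with rfl | h
      · simp
      · rw [diagonal_apply_ne _ h, hK0 i j h (hH i j)]
    have hTK' : ∀ i j, T i j * K j j = (1 : Matrix V V ℂ) i j := by
      intro i j
      rw [← hTK]
      nth_rw 2 [hKd]
      rw [mul_diagonal]
    ext i j
    rcases eq_or_ne i j with rfl | h
    · rw [diagonal_apply_eq, hTS i i (Or.inl rfl)]
    · rw [diagonal_apply_ne _ h]
      have h1 := hTK' i j
      rw [one_apply_ne h] at h1
      have h2 := hTK' j j
      rw [one_apply_eq] at h2
      exact (mul_eq_zero.1 h1).resolve_right (right_ne_zero_of_mul_eq_one h2)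
  · rintro rfl
    refine ⟨isSymm_diagonal _, fun i j hij => ?_, diagonal fun i => (S i i)⁻¹,
      ⟨isSymm_diagonal _, fun i j hij _ => diagonal_apply_ne _ hij⟩, ?_⟩
    · rw [or_iff_left (hH i j)] at hij
      rw [hij, diagonal_apply_eq]
    · rw [diagonal_mul_diagonal, ← diagonal_one]
      congr 1
      funext i
      exact mul_inv_cancel₀ (hne i)

/-- Elimination of a vertex `v` whose neighbours in `H` form a clique `N`. The column of `v` in
the inverse of a solution is determined, up to a factor, by the block of the data at `N ∪ {v}`;
the corresponding shear isolates `v` and turns the solutions for `H` into the solutions for the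
graph `H'` in which `v` has no neighbours. -/
theorem completions_eq_singleton_of_isolate {H H' : SimpleGraph V} {v : V}
    (hN : ∀ i j, H.Adj v i → H.Adj v j → i ≠ j → H.Adj i j)
    (hH' : ∀ i j, H'.Adj i j ↔ H.Adj i j ∧ i ≠ v ∧ j ≠ v)
    {S : Matrix V V ℂ} (hSs : S.IsSymm) (hS : RegularOnCliques H S)
    (ih : ∀ S' : Matrix V V ℂ, S'.IsSymm → RegularOnCliques H' S' → ∃ T, completions H' S' = {T}) :
    ∃ T, completions H S = {T} := by
  have hNv : S.NonsingularOn {i | H.Adj v i} := hS _ fun i hi j hj hij => hN i j hi hj hij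
  have hNv' : S.NonsingularOn (insert v {i | H.Adj v i}) := by
    refine hS _ ?_
    rw [SimpleGraph.isClique_insert]
    exact ⟨fun i hi j hj hij => hN i j hi hj hij, fun i hi _ => hi⟩
  obtain ⟨u, hu0, hu⟩ := hNv.exists_solution fun i => S i v
  have huv : u v = 0 := hu0 v H.irrefl
  have huN : ∀ i, u i ≠ 0 → H.Adj v i := fun i hi => by_contra fun h => hi (hu0 i h)
  -- the new entry of the data at `v`, a Schur complement
  set s : ℂ := S v v - u ⬝ᵥ (fun i => S i v) with hs
  let S' : Matrix V V ℂ := of fun i j => if i = v ∧ j = v then s else S i j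
  have hS's : S'.IsSymm := by
    ext i j
    by_cases hi : i = v <;> by_cases hj : j = v <;> simp [S', hi, hj, hSs.apply]
  have hsne : s ≠ 0 := by
    intro h0
    have := hNv' (Pi.single v 1 - u) ?_ ?_
    · simpa [huv] using congrFun this v
    · intro i hi
      simp only [Set.mem_insert_iff, Set.mem_ofPred_eq, not_or] at hi
      simp [hi.1, hu0 i hi.2]
    · rintro i (rfl | hi)
      · rw [mulVec_sub, Pi.sub_apply, mulVec_single_one, col_apply, ← h0, hs]
        simp only [mulVec, dotProduct]
        congr 1
        exact Finset.sum_congr rfl fun j _ => by rw [hSs.apply, mul_comm]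
      · rw [mulVec_sub, Pi.sub_apply, mulVec_single_one, col_apply, hu i hi, sub_self]
  have hS' : RegularOnCliques H' S' := by
    intro c hc x hx hSx
    by_cases hv : v ∈ c
    · have hcv : ∀ i, i ≠ v → x i = 0 := by
        intro i hi
        refine hx i fun hic => ?_
        exact ((hH' _ _).1 (hc hic hv hi)).2.2 rfl
      have hxe : x = Pi.single v (x v) := by
        ext i
        rcases eq_or_ne i v with rfl | hi
        · simp
        · simp [hi, hcv i hi]
      have := hSx v hv
      rw [hxe, mulVec_single] at this
      have hxv : x v = 0 := by simpa [S', hsne] using this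
      rw [hxe, hxv, Pi.single_zero]
    · refine hS c (fun i hi j hj hij => ((hH' _ _).1 (hc hi hj hij)).1) x hx fun i hi => ?_
      rw [← hSx i hi]
      have hiv : i ≠ v := fun h => hv (h ▸ hi)
      simp [S', mulVec, dotProduct, hiv]
  obtain ⟨T₀, hT₀⟩ := ih S' hS's hS'
  have hu2 : ∀ T : Matrix V V ℂ, (∀ i j, (i = j ∨ H.Adj i j) → i ≠ v → j ≠ v → T i j = S i j) →
      ∀ i, H.Adj v i → (T *ᵥ u) i = S i v := by
    intro T hT i hi
    rw [← hu i hi]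
    refine Finset.sum_congr rfl fun j _ => ?_
    by_cases hj : H.Adj v j
    · dsimp only
      rw [hT i j ?_ hi.ne' hj.ne']
      rcases eq_or_ne i j with h | h
      · exact Or.inl h
      · exact Or.inr (hN i j hi hj h)
    · simp [hu0 j hj]
  have huT : ∀ T : Matrix V V ℂ, (∀ i j, (i = j ∨ H.Adj i j) → i ≠ v → j ≠ v → T i j = S i j) →
      u ⬝ᵥ (T *ᵥ u) = u ⬝ᵥ fun i => S i v := by
    intro T hT
    refine Finset.sum_congr rfl fun i _ => ?_
    by_cases hi : H.Adj v i
    · rw [hu2 T hT i hi]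
    · simp [hu0 i hi]
  have huadj : ∀ i j, u i ≠ 0 → u j ≠ 0 → i ≠ j → H'.Adj i j := fun i j hi hj hij =>
    (hH' i j).2 ⟨hN i j (huN i hi) (huN j hj) hij, (huN i hi).ne', (huN j hj).ne'⟩
  -- from `H` to `H'`
  have fwd : ∀ T ∈ completions H S,
      shear v (-u) * T * (shear v (-u))ᵀ ∈ completions H' S' := by
    rintro T ⟨hT, hTS, K, ⟨hK, hK0⟩, hTK⟩
    have hKv : ∀ i, i ≠ v → K i v = -(K v v * u i) := by
      have hz : (fun i => if i = v then 0 else K i v) + K v v • u = 0 := by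
        refine hNv _ (fun i hi => ?_) fun i hi => ?_
        · rcases eq_or_ne i v with rfl | hiv
          · simp [huv]
          · simp [hiv, hu0 i hi, hK0 i v hiv fun h => hi h.symm]
        · have hiv : i ≠ v := hi.ne'
          have h1 : ∑ j, T i j * K j v = 0 := by
            have := congrFun (congrFun hTK i) v
            rwa [mul_apply, one_apply_ne hiv] at this
          rw [← Finset.add_sum_erase _ _ (Finset.mem_univ v)] at h1
          rw [mulVec_add, Pi.add_apply, mulVec_smul, Pi.smul_apply, hu i hi, smul_eq_mul,
            ← hTS i v (Or.inr hi.symm), mul_comm, add_comm]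
          refine Eq.trans ?_ h1
          congr 1
          rw [mulVec, dotProduct, ← Finset.add_sum_erase _ _ (Finset.mem_univ v), if_pos rfl,
            mul_zero, zero_add]
          refine Finset.sum_congr rfl fun j hj => ?_
          rw [if_neg (Finset.ne_of_mem_erase hj)]
          by_cases hvj : H.Adj v j
          · rw [hTS i j ?_]
            rcases eq_or_ne i j with h | h
            · exact Or.inl h
            · exact Or.inr (hN i j hi hvj h)
          · rw [hK0 j v (Finset.ne_of_mem_erase hj) fun h => hvj h.symm, mul_zero, mul_zero]
      intro i hi
      have := congrFun hz i
      simp only [Pi.add_apply, if_neg hi, Pi.smul_apply, smul_eq_mul, Pi.zero_apply] at this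
      exact eq_neg_of_add_eq_zero_left this
    refine ⟨hT.congr _, fun i j hij => ?_, _, ⟨?_, fun i j hij hnadj => ?_⟩,
      shear_congr_mul_eq_one huv hTK⟩
    · rw [shear_congr_apply hT]
      rcases hij with rfl | hij
      · by_cases hi : i = v
        · subst hi
          have h1 : (T *ᵥ u) i = u ⬝ᵥ fun j => S j i := by
            rw [mulVec, dotProduct_comm]
            refine Finset.sum_congr rfl fun j _ => ?_
            by_cases hj : H.Adj i j
            · dsimp only
              rw [hTS i j (Or.inr hj), hSs.apply]
            · simp [hu0 j hj]
          simp only [mulVec_neg, Pi.neg_apply, neg_dotProduct, dotProduct_neg, neg_neg, if_true,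
            and_self, S', of_apply, h1, huT T fun i j h _ _ => hTS i j h, hTS i i (Or.inl rfl), hs]
          ring
        · simp [hi, S', hTS i i (Or.inl rfl)]
      · obtain ⟨hij, hi, hj⟩ := (hH' i j).1 hij
        simp [hi, hj, S', hTS i j (Or.inr hij)]
    · simpa using hK.congr (shear v u)ᵀ
    · rw [shear_transpose_congr_apply]
      by_cases hi : i = v
      · subst hi
        rw [← hK.apply, hKv j hij.symm, huv]
        ring
      by_cases hj : j = v
      · subst hj
        rw [hKv i hi, huv]
        ring
      have h1 : u i * u j = 0 := by
        by_contra h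
        exact hnadj (huadj i j (left_ne_zero_of_mul h) (right_ne_zero_of_mul h) hij)
      rw [hK0 i j hij fun h => hnadj ((hH' i j).2 ⟨h, hi, hj⟩), ← hK.apply v j, hKv i hi, hKv j hj]
      linear_combination (-K v v) * h1
  -- from `H'` to `H`
  have bwd : shear v u * T₀ * (shear v u)ᵀ ∈ completions H S := by
    have hmem : T₀ ∈ completions H' S' := by rw [hT₀]; rfl
    obtain ⟨hT, hTS, K, ⟨hK, hK0⟩, hTK⟩ := hmem
    have hTS' : ∀ i j, (i = j ∨ H.Adj i j) → i ≠ v → j ≠ v → T₀ i j = S i j := by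
      intro i j hij hi hj
      rw [hTS i j (hij.imp id fun h => (hH' i j).2 ⟨h, hi, hj⟩)]
      simp [S', hi]
    have hKv : ∀ j, j ≠ v → K v j = 0 := fun j hj =>
      hK0 v j hj.symm fun h => ((hH' _ _).1 h).2.1 rfl
    have hTv : ∀ i, i ≠ v → T₀ i v = 0 := by
      have h1 : ∀ i, T₀ i v * K v v = (1 : Matrix V V ℂ) i v := by
        intro i
        rw [← hTK, mul_apply, Finset.sum_eq_single v]
        · intro j _ hj
          rw [← hK.apply, hKv j hj, mul_zero]
        · simp
      intro i hi
      have h2 := h1 i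
      rw [one_apply_ne hi] at h2
      have h3 := h1 v
      rw [one_apply_eq] at h3
      exact (mul_eq_zero.1 h2).resolve_right (right_ne_zero_of_mul_eq_one h3)
    have hTvu : (T₀ *ᵥ u) v = 0 := by
      refine Finset.sum_eq_zero fun j _ => ?_
      rcases eq_or_ne j v with rfl | hj
      · rw [huv, mul_zero]
      · dsimp only
        rw [← hT.apply, hTv j hj, zero_mul]
    refine ⟨hT.congr _, fun i j hij => ?_, (shear v (-u))ᵀ * K * shear v (-u),
      ⟨by simpa using hK.congr (shear v (-u))ᵀ, fun i j hij hnadj => ?_⟩, ?_⟩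
    · rw [shear_congr_apply hT]
      rcases hij with rfl | hij
      · by_cases hi : i = v
        · subst hi
          simp only [if_true, and_self, hTvu, huT T₀ hTS', hTS i i (Or.inl rfl), S', of_apply, hs]
          ring
        · simp [hi, hTS' i i (Or.inl rfl) hi hi]
      · by_cases hi : i = v
        · subst hi
          have hj : j ≠ i := hij.ne'
          simp [hj, hu2 T₀ hTS' j hij, ← hT.apply i j, hTv j hj, hSs.apply]
        by_cases hj : j = v
        · subst hj
          simp [hi, hu2 T₀ hTS' i hij.symm, hTv i hi]
        simp [hi, hj, hTS' i j (Or.inr hij) hi hj]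
    · rw [shear_transpose_congr_apply]
      have h1 : (-u) i * (-u) j = 0 := by
        by_contra h
        have h2 : u i ≠ 0 ∧ u j ≠ 0 := by simpa using h
        exact hnadj ((hH' i j).1 (huadj i j h2.1 h2.2 hij)).1
      have h2 : K i j = 0 := hK0 i j hij fun h => hnadj ((hH' i j).1 h).1
      have h3 : (-u) i * K v j = 0 := by
        rcases eq_or_ne j v with rfl | hj
        · have : u i = 0 := hu0 i fun h => hnadj h.symm
          simp [this]
        · rw [hKv j hj, mul_zero]
      have h4 : K i v * (-u) j = 0 := by
        rcases eq_or_ne i v with rfl | hi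
        · have : u j = 0 := hu0 j hnadj
          simp [this]
        · rw [← hK.apply, hKv i hi, zero_mul]
      rw [h1, h2, h3, h4]
      ring
    · simpa using shear_congr_mul_eq_one (u := -u) (by simpa using huv) hTK
  refine ⟨shear v u * T₀ * (shear v u)ᵀ, Set.eq_singleton_iff_unique_mem.2 ⟨bwd, fun T hT => ?_⟩⟩
  have h1 := fwd T hT
  rw [hT₀, Set.mem_singleton_iff] at h1
  have h2 : (shear v (-u))ᵀ * (shear v u)ᵀ = 1 := by
    rw [← transpose_mul, shear_mul_shear_neg huv, transpose_one]
  calc T = (shear v u * shear v (-u)) * T * ((shear v (-u))ᵀ * (shear v u)ᵀ) := by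
        rw [shear_mul_shear_neg huv, h2, Matrix.one_mul, Matrix.mul_one]
    _ = shear v u * T₀ * (shear v u)ᵀ := by
        rw [← h1]
        simp only [Matrix.mul_assoc]

/-- A chordal graph has exactly one solution at all data that are regular on its cliques. -/
theorem SimpleGraph.IsChordalGraph.completions_eq_singleton {G : SimpleGraph V}
    (hG : G.IsChordalGraph) (n : ℕ) : ∀ U : Finset V, U.card = n → ∀ S : Matrix V V ℂ, S.IsSymm →
      RegularOnCliques (G.inside U) S → ∃ T, completions (G.inside U) S = {T} := by
  induction n with
  | zero =>
    intro U hU S _ hS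
    rw [Finset.card_eq_zero] at hU
    subst hU
    exact ⟨_, completions_of_forall_not_adj (fun i j h => by simpa using h.1) hS⟩
  | succ n ih =>
    intro U hU S hSs hS
    obtain ⟨v, hv⟩ := hG.exists_isSimplicialIn (U := U) (Finset.card_pos.1 (by omega))
    refine completions_eq_singleton_of_isolate (H' := G.inside (U.erase v)) (v := v)
      (fun i j hi hj hij => ?_) (fun i j => ?_) hSs hS (ih _ ?_)
    · exact ⟨hi.2.1, hj.2.1, hv.2 i hi.2.1 j hj.2.1 hi.2.2 hj.2.2 hij⟩
    · simp only [SimpleGraph.inside, Finset.coe_erase, Set.mem_sdiff, Set.mem_singleton_iff]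
      tauto
    · rw [Finset.card_erase_of_mem hv.1, hU]
      rfl

/-- The product of all principal minors is a polynomial that witnesses genericity. -/
theorem SimpleGraph.IsChordalGraph.hasMLDegree_one {G : SimpleGraph V}
    (hG : G.IsChordalGraph) : HasMLDegree G 1 := by
  let X : Matrix V V (MvPolynomial (V × V) ℝ) := of fun i j => MvPolynomial.X (i, j)
  have heval : ∀ (S : Matrix V V ℝ) (s : Finset V),
      MvPolynomial.eval (fun e => S e.1 e.2) (mask _ X s).det = (mask ℝ S s).det := by
    intro S s
    rw [RingHom.map_det]
    congr 1
    ext i j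
    by_cases h : i ∈ s ∧ j ∈ s
    · simp [mask, X, h]
    · simp only [mask, of_apply, if_neg h, RingHom.mapMatrix_apply, map_apply]
      split_ifs <;> simp
  refine ⟨∏ s ∈ (Finset.univ : Finset V).powerset, (mask _ X s).det, ⟨1, isSymm_one, ?_⟩,
    fun S hS hp => ?_⟩
  · rw [map_prod, Finset.prod_ne_zero_iff]
    intro s _
    rw [heval]
    have : mask ℝ (1 : Matrix V V ℝ) s = 1 := by
      ext i j
      rcases eq_or_ne i j with rfl | hij
      · simp [mask]
      · simp [mask, hij]
    rw [this, det_one]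
    exact one_ne_zero
  · rw [map_prod, Finset.prod_ne_zero_iff] at hp
    have hU : G.inside (Finset.univ : Finset V) = G := by
      ext i j
      simp [SimpleGraph.inside]
    have key := hG.completions_eq_singleton _ Finset.univ rfl (S.map Complex.ofReal)
      (by ext i j; simp [hS.apply i j]) ?_
    · obtain ⟨T, hT⟩ := key
      rw [hU] at hT
      have : likelihoodSolutions G S = {T} := hT
      rw [this, Set.encard_singleton, Nat.cast_one]
    · intro c _
      classical
      have h1 := hp c.toFinset (by simp)
      rw [heval] at h1
      have h2 : mask ℂ (S.map Complex.ofReal) c.toFinset =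
          (mask ℝ S c.toFinset).map Complex.ofRealHom := by
        ext i j
        simp only [mask, of_apply, map_apply]
        split_ifs <;> simp
      have h3 := nonsingularOn_of_det_mask_ne_zero (A := S.map Complex.ofReal)
        (s := c.toFinset) (by
          rw [h2, ← RingHom.mapMatrix_apply, ← RingHom.map_det]
          simpa using h1)
      simpa using h3

end Elimination

/-! ### Nondegenerate pairs of solutions -/

open Matrix Topology Filter

section NondegeneratePairs

variable {V : Type*}

/-- The real linear space of the Gaussian graphical model of `G`. -/
def realConcentrationSpace (G : SimpleGraph V) : Submodule ℝ (Matrix V V ℝ) where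
  carrier := {K | K.IsSymm ∧ ∀ i j, i ≠ j → ¬ G.Adj i j → K i j = 0}
  add_mem' := by
    rintro A B ⟨hA, hA'⟩ ⟨hB, hB'⟩
    refine ⟨hA.add hB, fun i j hij h => ?_⟩
    simp [hA' i j hij h, hB' i j hij h]
  zero_mem' := ⟨isSymm_zero, fun _ _ _ _ => rfl⟩
  smul_mem' := by
    rintro a A ⟨hA, hA'⟩
    refine ⟨hA.smul a, fun i j hij h => ?_⟩
    simp [hA' i j hij h]

/-- The projection of a matrix to the diagonal and the edges of `G`, symmetrized. -/
noncomputable def edgeProjection (G : SimpleGraph V) :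
    Matrix V V ℝ →ₗ[ℝ] realConcentrationSpace G := by
  classical
  exact
  { toFun := fun M => ⟨of fun i j => if i = j ∨ G.Adj i j then (M i j + M j i) / 2 else 0, by
      refine ⟨?_, fun i j hij h => by simp [hij, h]⟩
      ext i j
      simp [eq_comm, G.adj_comm, add_comm]⟩
    map_add' := by
      intro A B
      ext i j
      by_cases h : i = j ∨ G.Adj i j
      · simp only [of_apply, if_pos h, Matrix.add_apply, Submodule.coe_add]
        ring
      · simp [h]
    map_smul' := by
      intro a A
      ext i j
      by_cases h : i = j ∨ G.Adj i j
      · simp only [of_apply, if_pos h, Matrix.smul_apply, Submodule.coe_smul, smul_eq_mul,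
          RingHom.id_apply]
        ring
      · simp [h] }

theorem edgeProjection_apply {G : SimpleGraph V} {M : Matrix V V ℝ} (hM : M.IsSymm) {i j : V}
    (h : i = j ∨ G.Adj i j) : (edgeProjection G M : Matrix V V ℝ) i j = M i j := by
  simp only [edgeProjection, LinearMap.coe_mk, AddHom.coe_mk, of_apply, if_pos h, hM.apply]
  ring

theorem edgeProjection_congr {G : SimpleGraph V} {M N : Matrix V V ℝ} (hM : M.IsSymm)
    (hN : N.IsSymm) (h : ∀ i j, (i = j ∨ G.Adj i j) → M i j = N i j) :
    edgeProjection G M = edgeProjection G N := by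
  ext i j
  by_cases hij : i = j ∨ G.Adj i j
  · rw [edgeProjection_apply hM hij, edgeProjection_apply hN hij, h i j hij]
  · rw [not_or] at hij
    rw [(edgeProjection G M).2.2 i j hij.1 hij.2, (edgeProjection G N).2.2 i j hij.1 hij.2]

variable [Fintype V] [DecidableEq V]

/-- The derivative `X ↦ -T * X * T` of the matrix inverse, followed by the projection to the
diagonal and the edges of `G`, is injective on the linear space of the model. -/
def EdgeNondegenerate (G : SimpleGraph V) (T : Matrix V V ℝ) : Prop :=
  ∀ X ∈ realConcentrationSpace G, (∀ i j, (i = j ∨ G.Adj i j) → (T * X * T) i j = 0) → X = 0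

attribute [local instance] Matrix.linftyOpNormedRing Matrix.linftyOpNormedAlgebra

/-- By the inverse function theorem, the data near those of a nondegenerate solution have a
solution near it. -/
theorem EdgeNondegenerate.image_mem_nhds {G : SimpleGraph V} {T : Matrix V V ℝ}
    (hT : EdgeNondegenerate G T) (hTs : T.IsSymm) (K : realConcentrationSpace G)
    (hTK : T * (K : Matrix V V ℝ) = 1) {A : Set (realConcentrationSpace G)} (hA : A ∈ 𝓝 K) :
    (fun L : realConcentrationSpace G => edgeProjection G (Ring.inverse (L : Matrix V V ℝ))) '' A ∈
      𝓝 (edgeProjection G T) := by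
  have hKT : (K : Matrix V V ℝ) * T = 1 := mul_eq_one_comm.1 hTK
  let x : (Matrix V V ℝ)ˣ := ⟨K, T, hKT, hTK⟩
  let P : Matrix V V ℝ →L[ℝ] realConcentrationSpace G := (edgeProjection G).toContinuousLinearMap
  let ι : realConcentrationSpace G →L[ℝ] Matrix V V ℝ := (realConcentrationSpace G).subtypeL
  let D : realConcentrationSpace G →L[ℝ] realConcentrationSpace G :=
    P.comp ((-ContinuousLinearMap.mulLeftRight ℝ (Matrix V V ℝ) ↑x⁻¹ ↑x⁻¹).comp ι)
  have hD : HasStrictFDerivAt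
      (fun L : realConcentrationSpace G => edgeProjection G (Ring.inverse (L : Matrix V V ℝ)))
      D K :=
    P.hasStrictFDerivAt.comp K ((hasStrictFDerivAt_ringInverse x).comp K ι.hasStrictFDerivAt)
  have hDX : ∀ X, D X = -edgeProjection G (T * X * T) := by
    intro X
    have : D X = edgeProjection G (-(T * X * T)) := rfl
    rw [this, map_neg]
  have hinj : Function.Injective (D : realConcentrationSpace G →ₗ[ℝ] realConcentrationSpace G) := by
    rw [← LinearMap.ker_eq_bot, LinearMap.ker_eq_bot']
    intro X hX
    have hX' : edgeProjection G (T * X * T) = 0 := by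
      have := hDX X
      rw [show D X = 0 from hX] at this
      exact neg_eq_zero.1 this.symm
    have hsymm : (T * (X : Matrix V V ℝ) * T).IsSymm := by
      have := IsSymm.congr X.2.1 T
      rwa [hTs.eq] at this
    refine Subtype.ext (hT X X.2 fun i j hij => ?_)
    rw [← edgeProjection_apply hsymm hij, hX']
    rfl
  have hsurj : D.range = ⊤ := LinearMap.range_eq_top.2 (LinearMap.surjective_of_injective hinj)
  have hmap := hD.map_nhds_eq_of_surj hsurj
  have hinv : Ring.inverse (K : Matrix V V ℝ) = T := Ring.inverse_unit x
  rw [← hinv]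
  exact hmap.ge (image_mem_map hA)

/-- A polynomial that does not vanish at the end of a segment vanishes at no point of the segment
that is close to its beginning, except possibly at the beginning. -/
theorem eventually_eval_segment_ne_zero {σ : Type*} (p : MvPolynomial σ ℝ) (x y : σ → ℝ)
    (hy : MvPolynomial.eval y p ≠ 0) :
    ∀ᶠ t : ℝ in 𝓝[≠] 0, MvPolynomial.eval (fun e => x e + t * (y e - x e)) p ≠ 0 := by
  let q : Polynomial ℝ := MvPolynomial.aeval
    (fun e => Polynomial.C (x e) + Polynomial.X * Polynomial.C (y e - x e)) p
  have hq : ∀ t, q.eval t = MvPolynomial.eval (fun e => x e + t * (y e - x e)) p := by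
    intro t
    have h := MvPolynomial.map_aeval (R := ℝ)
      (fun e => Polynomial.C (x e) + Polynomial.X * Polynomial.C (y e - x e))
      (Polynomial.evalRingHom t) p
    rw [Polynomial.coe_evalRingHom] at h
    rw [show q.eval t = _ from h, MvPolynomial.eval]
    congr 2
    · ext a
      simp
    · funext e
      simp
  have hq0 : q ≠ 0 := by
    intro h
    apply hy
    have := hq 1
    rw [h] at this
    simpa using this.symm
  have hfin : {t | q.IsRoot t}.Finite := Polynomial.finite_setOfPred_isRoot hq0
  filter_upwards [nhdsNE_le_cofinite 0 hfin.compl_mem_cofinite] with t ht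
  rw [← hq]
  exact ht

/-- Two distinct nondegenerate solutions for the same data persist for all nearby data, so the
maximum likelihood degree is not one. -/
theorem not_hasMLDegree_one_of_nondegenerate {G : SimpleGraph V} {K₁ K₂ T₁ T₂ : Matrix V V ℝ}
    (hK₁ : K₁ ∈ realConcentrationSpace G) (hK₂ : K₂ ∈ realConcentrationSpace G) (hne : K₁ ≠ K₂)
    (hT₁ : T₁.IsSymm) (hT₂ : T₂.IsSymm) (hTK₁ : T₁ * K₁ = 1) (hTK₂ : T₂ * K₂ = 1)
    (hT : ∀ i j, (i = j ∨ G.Adj i j) → T₁ i j = T₂ i j)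
    (hn₁ : EdgeNondegenerate G T₁) (hn₂ : EdgeNondegenerate G T₂) : ¬ HasMLDegree G 1 := by
  rintro ⟨p, ⟨S₁, hS₁, hpS₁⟩, hp⟩
  let k₁ : realConcentrationSpace G := ⟨K₁, hK₁⟩
  let k₂ : realConcentrationSpace G := ⟨K₂, hK₂⟩
  have hk : k₁ ≠ k₂ := fun h => hne (congrArg Subtype.val h)
  obtain ⟨A₁, A₂, hA₁o, hA₂o, hA₁, hA₂, hdisj⟩ := t2_separation hk
  have hunit : IsOpen {L : realConcentrationSpace G | IsUnit (L : Matrix V V ℝ)} :=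
    Units.isOpen.preimage continuous_subtype_val
  have hu₁ : IsUnit K₁ := ⟨⟨K₁, T₁, mul_eq_one_comm.1 hTK₁, hTK₁⟩, rfl⟩
  have hu₂ : IsUnit K₂ := ⟨⟨K₂, T₂, mul_eq_one_comm.1 hTK₂, hTK₂⟩, rfl⟩
  have h₁ := hn₁.image_mem_nhds hT₁ k₁ hTK₁ ((hA₁o.inter hunit).mem_nhds ⟨hA₁, hu₁⟩)
  have h₂ := hn₂.image_mem_nhds hT₂ k₂ hTK₂ ((hA₂o.inter hunit).mem_nhds ⟨hA₂, hu₂⟩)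
  rw [← edgeProjection_congr hT₁ hT₂ hT] at h₂
  -- generic data on a segment that begins at the common data of the two solutions
  let c : ℝ → Matrix V V ℝ := fun t => T₁ + t • (S₁ - T₁)
  have hc : Continuous fun t => edgeProjection G (c t) :=
    (edgeProjection G).toContinuousLinearMap.continuous.comp (by fun_prop)
  have hc0 : c 0 = T₁ := by simp [c]
  have hev : ∀ᶠ t in 𝓝[≠] (0 : ℝ), MvPolynomial.eval (fun e => c t e.1 e.2) p ≠ 0 :=
    eventually_eval_segment_ne_zero p (fun e => T₁ e.1 e.2) (fun e => S₁ e.1 e.2) hpS₁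
  have hev' : ∀ᶠ t in 𝓝[≠] (0 : ℝ), edgeProjection G (c t) ∈
      (fun L : realConcentrationSpace G => edgeProjection G (Ring.inverse (L : Matrix V V ℝ))) ''
        (A₁ ∩ {L | IsUnit (L : Matrix V V ℝ)}) ∩
      (fun L : realConcentrationSpace G => edgeProjection G (Ring.inverse (L : Matrix V V ℝ))) ''
        (A₂ ∩ {L | IsUnit (L : Matrix V V ℝ)}) := by
    refine (hc.tendsto 0).mono_left nhdsWithin_le_nhds ?_
    rw [hc0]
    exact inter_mem h₁ h₂
  obtain ⟨t, hpt, ⟨L₁, ⟨hL₁, hLu₁⟩, he₁⟩, ⟨L₂, ⟨hL₂, hLu₂⟩, he₂⟩⟩ := (hev.and hev').exists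
  have hcs : (c t).IsSymm := hT₁.add ((hS₁.sub hT₁).smul t)
  have hsol : ∀ L : realConcentrationSpace G, IsUnit (L : Matrix V V ℝ) →
      edgeProjection G (Ring.inverse (L : Matrix V V ℝ)) = edgeProjection G (c t) →
      (Ring.inverse (L : Matrix V V ℝ)).map Complex.ofReal ∈ likelihoodSolutions G (c t) := by
    intro L hLu he
    have hinvs : (Ring.inverse (L : Matrix V V ℝ)).IsSymm := by
      rw [← nonsing_inv_eq_ringInverse, IsSymm, transpose_nonsing_inv, L.2.1.eq]
    refine ⟨by ext i j; simp [hinvs.apply i j], fun i j hij => ?_,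
      (L : Matrix V V ℝ).map Complex.ofReal, ⟨by ext i j; simp [L.2.1.apply i j],
        fun i j hij h => by simp [L.2.2 i j hij h]⟩, ?_⟩
    · rw [map_apply, ← edgeProjection_apply hinvs hij, he, edgeProjection_apply hcs hij]
    · have h := congrArg (fun M => M.map Complex.ofRealHom) (Ring.inverse_mul_cancel _ hLu)
      rw [Matrix.map_mul] at h
      exact h.trans (by simp)
  have hs₁ := hsol L₁ hLu₁ he₁
  have hs₂ := hsol L₂ hLu₂ he₂
  obtain ⟨T, hTeq⟩ := Set.encard_eq_one.1 ((hp (c t) hcs hpt).trans Nat.cast_one)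
  rw [hTeq, Set.mem_singleton_iff] at hs₁ hs₂
  have hinv : Ring.inverse (L₁ : Matrix V V ℝ) = Ring.inverse (L₂ : Matrix V V ℝ) :=
    Matrix.map_injective Complex.ofReal_injective (hs₁.trans hs₂.symm)
  have hL : L₁ = L₂ := by
    refine Subtype.ext ?_
    calc (L₁ : Matrix V V ℝ) = L₁ * (Ring.inverse (L₂ : Matrix V V ℝ) * L₂) := by
          rw [Ring.inverse_mul_cancel _ hLu₂, mul_one]
      _ = L₂ := by rw [← hinv, ← mul_assoc, Ring.mul_inverse_cancel _ hLu₁, one_mul]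
  exact Set.disjoint_left.1 hdisj hL₁ (hL ▸ hL₂)

end NondegeneratePairs

/-! ### Cut certificates -/

/-- A nondegenerate solution `T` with inverse `K` for the graph `G` that vanishes at the edges
between `B` and its complement, although `K` does not. Changing the signs of the rows and columns
in `B` gives a second solution for the same data. The condition on principal submatrices makes it
possible to add vertices to `G`. -/
structure CutCertificate {V : Type*} [Fintype V] [DecidableEq V] (G : SimpleGraph V)
    (T K : Matrix V V ℝ) (B : Set V) : Prop where
  symm : T.IsSymm
  mem : K ∈ realConcentrationSpace G
  mul_eq_one : T * K = 1
  cut : ∀ i j, G.Adj i j → i ∈ B → j ∉ B → T i j = 0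
  exists_ne : ∃ i j, i ∈ B ∧ j ∉ B ∧ K i j ≠ 0
  nondegenerate : EdgeNondegenerate G T
  nonsingularOn : ∀ s : Set V, T.NonsingularOn s

namespace CutCertificate

section Sign

variable {V : Type*} [Fintype V] [DecidableEq V] {G : SimpleGraph V} {T K : Matrix V V ℝ}
  {B : Set V}

/-- Conjugation by the diagonal sign matrix `D` of the cut gives the second solution. -/
theorem not_hasMLDegree_one (h : CutCertificate G T K B) : ¬ HasMLDegree G 1 := by
  classical
  let d : V → ℝ := fun i => if i ∈ B then -1 else 1
  have hd : ∀ i, d i * d i = 1 := by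
    intro i
    by_cases hi : i ∈ B <;> simp [d, hi]
  let D : Matrix V V ℝ := diagonal d
  have hDD : D * D = 1 := by
    rw [diagonal_mul_diagonal, ← diagonal_one]
    congr 1
    funext i
    exact hd i
  have hDap : ∀ (M : Matrix V V ℝ) i j, (D * M * D) i j = d i * M i j * d j := by
    intro M i j
    rw [mul_diagonal, diagonal_mul]
  have hDmul : ∀ M N : Matrix V V ℝ, (D * M * D) * (D * N * D) = D * (M * N) * D := by
    intro M N
    calc (D * M * D) * (D * N * D) = D * M * (D * D) * N * D := by simp only [Matrix.mul_assoc]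
      _ = D * (M * N) * D := by rw [hDD]; simp only [Matrix.mul_assoc, Matrix.one_mul]
  have hDmem : ∀ M ∈ realConcentrationSpace G, D * M * D ∈ realConcentrationSpace G := by
    rintro M ⟨hM, hM0⟩
    refine ⟨?_, fun i j hij hadj => by rw [hDap, hM0 i j hij hadj, mul_zero, zero_mul]⟩
    ext i j
    rw [transpose_apply, hDap, hDap, hM.apply]
    ring
  have hinv : ∀ M : Matrix V V ℝ, D * (D * M * D) * D = M := by
    intro M
    calc D * (D * M * D) * D = (D * D) * M * (D * D) := by simp only [Matrix.mul_assoc]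
      _ = M := by rw [hDD, Matrix.one_mul, Matrix.mul_one]
  refine not_hasMLDegree_one_of_nondegenerate h.mem (hDmem K h.mem) ?_ h.symm
    (T₂ := D * T * D) ?_ h.mul_eq_one ?_ ?_ h.nondegenerate ?_
  · obtain ⟨i, j, hi, hj, hK⟩ := h.exists_ne
    intro heq
    have := congrFun (congrFun heq i) j
    rw [hDap] at this
    simp only [d, hi, hj, if_true, if_false] at this
    apply hK
    linarith
  · ext i j
    rw [transpose_apply, hDap, hDap, h.symm.apply]
    ring
  · rw [hDmul, h.mul_eq_one, Matrix.mul_one, hDD]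
  · intro i j hij
    rw [hDap]
    rcases hij with rfl | hij
    · linear_combination (-T i i) * hd i
    by_cases hi : i ∈ B <;> by_cases hj : j ∈ B
    · simp [d, hi, hj]
    · simp [h.cut i j hij hi hj]
    · simp [← h.symm.apply i j, h.cut j i hij.symm hj hi]
    · simp [d, hi, hj]
  · intro X hX hT
    have h1 : D * T * D * X * (D * T * D) = D * (T * (D * X * D) * T) * D := by
      simp only [Matrix.mul_assoc]
    have h2 := h.nondegenerate (D * X * D) (hDmem X hX) fun i j hij => by
      have := hT i j hij
      rw [h1, hDap] at this
      have hdi : d i ≠ 0 := left_ne_zero_of_mul_eq_one (hd i)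
      have hdj : d j ≠ 0 := left_ne_zero_of_mul_eq_one (hd j)
      simpa [hdi, hdj] using this
    rw [← hinv X, h2, Matrix.mul_zero, Matrix.zero_mul]

end Sign

end CutCertificate

section Extension

variable {ι V : Type*} [DecidableEq V]

/-- The extension of a matrix by the identity along an injective map of index sets. -/
noncomputable def Matrix.extendOne (f : ι → V) (A : Matrix ι ι ℝ) : Matrix V V ℝ := by
  classical
  exact of fun i j => if h : (∃ a, f a = i) ∧ ∃ b, f b = j then A h.1.choose h.2.choose
    else if i = j then 1 else 0

variable {f : ι → V}

theorem Matrix.extendOne_apply (hf : Function.Injective f) (A : Matrix ι ι ℝ) (a b : ι) :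
    extendOne f A (f a) (f b) = A a b := by
  have h : (∃ a', f a' = f a) ∧ ∃ b', f b' = f b := ⟨⟨a, rfl⟩, ⟨b, rfl⟩⟩
  rw [extendOne, of_apply, dif_pos h]
  rw [hf h.1.choose_spec, hf h.2.choose_spec]

theorem Matrix.extendOne_left (A : Matrix ι ι ℝ) {i : V} (hi : i ∉ Set.range f) (j : V) :
    extendOne f A i j = if i = j then 1 else 0 := by
  rw [extendOne, of_apply, dif_neg]
  rintro ⟨⟨a, rfl⟩, -⟩
  exact hi ⟨a, rfl⟩

theorem Matrix.extendOne_right (A : Matrix ι ι ℝ) (i : V) {j : V} (hj : j ∉ Set.range f) :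
    extendOne f A i j = if i = j then 1 else 0 := by
  rw [extendOne, of_apply, dif_neg]
  rintro ⟨-, ⟨a, rfl⟩⟩
  exact hj ⟨a, rfl⟩

theorem Matrix.mul_apply_eq_mulVec {V K : Type*} [Fintype V] [Field K] (A M : Matrix V V K)
    (i j : V) : (A * M) i j = (A *ᵥ fun k => M k j) i := rfl

theorem Matrix.IsSymm.extendOne (hf : Function.Injective f) {A : Matrix ι ι ℝ} (hA : A.IsSymm) :
    (Matrix.extendOne f A).IsSymm := by
  ext i j
  rw [transpose_apply]
  by_cases hi : i ∈ Set.range f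
  · by_cases hj : j ∈ Set.range f
    · obtain ⟨a, rfl⟩ := hi
      obtain ⟨b, rfl⟩ := hj
      rw [extendOne_apply hf, extendOne_apply hf, hA.apply]
    · rw [extendOne_left A hj, extendOne_right A i hj]
      simp only [eq_comm]
  · rw [extendOne_left A hi, extendOne_right A j hi]
    simp only [eq_comm]

variable [Fintype V]

theorem Matrix.extendOne_mulVec_of_notMem (A : Matrix ι ι ℝ) (x : V → ℝ) {i : V}
    (hi : i ∉ Set.range f) : (extendOne f A *ᵥ x) i = x i := by
  simp [mulVec, dotProduct, extendOne_left A hi]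

variable [Fintype ι]

theorem Matrix.extendOne_mulVec (hf : Function.Injective f) (A : Matrix ι ι ℝ) (x : V → ℝ)
    (a : ι) : (extendOne f A *ᵥ x) (f a) = (A *ᵥ (x ∘ f)) a := by
  symm
  refine Fintype.sum_of_injective f hf _ _ (fun k hk => ?_) fun b => ?_
  · dsimp only
    rw [extendOne_right A _ hk, if_neg, zero_mul]
    rintro rfl
    exact hk ⟨a, rfl⟩
  · dsimp only
    rw [extendOne_apply hf, Function.comp_apply]

/-- A certificate on an induced subgraph extends to the whole graph: a new vertex `k` contributes
to the linearized equations the principal subsystem at the old neighbours of `k`. -/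
theorem CutCertificate.extend [DecidableEq ι] (hf : Function.Injective f) {H : SimpleGraph ι}
    {G : SimpleGraph V} (hG : ∀ a b, G.Adj (f a) (f b) ↔ H.Adj a b) {T K : Matrix ι ι ℝ} {B : Set ι}
    (h : CutCertificate H T K B) :
    CutCertificate G (extendOne f T) (extendOne f K) (f '' B) where
  symm := h.symm.extendOne hf
  mem := by
    refine ⟨h.mem.1.extendOne hf, fun i j hij hadj => ?_⟩
    by_cases hi : i ∈ Set.range f
    · by_cases hj : j ∈ Set.range f
      · obtain ⟨a, rfl⟩ := hi
        obtain ⟨b, rfl⟩ := hj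
        rw [extendOne_apply hf]
        exact h.mem.2 a b (fun hab => hij (hab ▸ rfl)) fun hab => hadj ((hG a b).2 hab)
      · rw [extendOne_right K i hj, if_neg hij]
    · rw [extendOne_left K hi, if_neg hij]
  mul_eq_one := by
    ext i j
    rw [mul_apply_eq_mulVec]
    by_cases hi : i ∈ Set.range f
    · obtain ⟨a, rfl⟩ := hi
      rw [extendOne_mulVec hf]
      by_cases hj : j ∈ Set.range f
      · obtain ⟨b, rfl⟩ := hj
        have h1 : (fun k => extendOne f K k (f b)) ∘ f = fun c => K c b := by
          funext c
          exact extendOne_apply hf K c b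
        rw [h1]
        have h2 : (T *ᵥ fun c => K c b) a = (T * K) a b := rfl
        rw [h2, h.mul_eq_one, one_apply, one_apply]
        simp only [hf.eq_iff]
      · have h1 : (fun k => extendOne f K k j) ∘ f = 0 := by
          funext c
          rw [Function.comp_apply, extendOne_right K _ hj, if_neg]
          · rfl
          · rintro rfl
            exact hj ⟨c, rfl⟩
        rw [h1, mulVec_zero, Pi.zero_apply, one_apply_ne]
        rintro rfl
        exact hj ⟨a, rfl⟩
    · rw [extendOne_mulVec_of_notMem T _ hi, extendOne_left K hi, one_apply]
  cut := by
    rintro _ j hadj ⟨a, ha, rfl⟩ hj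
    by_cases hjr : j ∈ Set.range f
    · obtain ⟨b, rfl⟩ := hjr
      rw [extendOne_apply hf]
      exact h.cut a b ((hG a b).1 hadj) ha fun hb => hj ⟨b, hb, rfl⟩
    · rw [extendOne_right T _ hjr, if_neg hadj.ne]
  exists_ne := by
    obtain ⟨a, b, ha, hb, hK⟩ := h.exists_ne
    refine ⟨f a, f b, ⟨a, ha, rfl⟩, ?_, by rwa [extendOne_apply hf]⟩
    rintro ⟨c, hc, hcb⟩
    exact hb (hf hcb ▸ hc)
  nondegenerate := by
    intro X hX hTX
    have hTs := h.symm.extendOne hf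
    -- the product evaluated column by column
    have hcol : ∀ i j, (extendOne f T * X * extendOne f T) i j =
        (extendOne f T *ᵥ fun k => (extendOne f T *ᵥ X k) j) i := by
      intro i j
      rw [Matrix.mul_assoc, mul_apply_eq_mulVec]
      congr 2
      funext k
      rw [← hTs.vecMul_eq]
      rfl
    have hout : ∀ k, k ∉ Set.range f → ∀ j, X k j = 0 := by
      intro k hk j
      by_cases hj : j ∈ Set.range f
      · have h1 := h.nonsingularOn {c | G.Adj k (f c)} (X k ∘ f) (fun c hc => ?_) fun c hc => ?_
        · obtain ⟨b, rfl⟩ := hj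
          exact congrFun h1 b
        · refine hX.2 k (f c) ?_ hc
          rintro rfl
          exact hk ⟨c, rfl⟩
        · rw [← extendOne_mulVec hf, ← hTX k (f c) (Or.inr hc), hcol,
            extendOne_mulVec_of_notMem T _ hk]
      · by_cases hkj : k = j ∨ G.Adj k j
        · have := hTX k j hkj
          rwa [hcol, extendOne_mulVec_of_notMem T _ hk, extendOne_mulVec_of_notMem T _ hj] at this
        · rw [not_or] at hkj
          exact hX.2 k j hkj.1 hkj.2
    have hin : X.submatrix f f = 0 := by
      refine h.nondegenerate _ ⟨?_, fun a b hab hadj => ?_⟩ fun a b hab => ?_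
      · ext a b
        exact hX.1.apply _ _
      · exact hX.2 _ _ (fun h' => hab (hf h')) fun h' => hadj ((hG a b).1 h')
      · rw [← hTX (f a) (f b) (hab.imp (congrArg f) (hG a b).2), hcol, extendOne_mulVec hf,
          Matrix.mul_assoc, mul_apply_eq_mulVec]
        congr 2
        funext c
        rw [Function.comp_apply, extendOne_mulVec hf, ← h.symm.vecMul_eq]
        rfl
    ext i j
    by_cases hi : i ∈ Set.range f
    · by_cases hj : j ∈ Set.range f
      · obtain ⟨a, rfl⟩ := hi
        obtain ⟨b, rfl⟩ := hj
        exact congrFun (congrFun hin a) b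
      · rw [← hX.1.apply, hout j hj, Matrix.zero_apply]
    · rw [hout i hi, Matrix.zero_apply]
  nonsingularOn := by
    intro s x hx hT
    have hout : ∀ i, i ∉ Set.range f → x i = 0 := by
      intro i hi
      by_cases his : i ∈ s
      · rw [← hT i his, extendOne_mulVec_of_notMem T x hi]
      · exact hx i his
    have hin := h.nonsingularOn (f ⁻¹' s) (x ∘ f) (fun a ha => hx _ ha) fun a ha => by
      rw [← extendOne_mulVec hf, hT _ ha]
    funext i
    by_cases hi : i ∈ Set.range f
    · obtain ⟨a, rfl⟩ := hi
      exact congrFun hin a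
    · exact hout i hi

end Extension

/-! ### The cycle of length four -/

/-- The cycle on the vertices `0, 1, …, n - 1`. -/
def cycleOn (n : ℕ) : SimpleGraph (Fin n) where
  Adj a b := a ≠ b ∧ (a.val + 1 = b.val ∨ b.val + 1 = a.val ∨ (a.val = 0 ∧ b.val + 1 = n) ∨
    (b.val = 0 ∧ a.val + 1 = n))
  symm := ⟨fun _ _ h => ⟨h.1.symm, by tauto⟩⟩
  loopless := ⟨fun _ h => h.1 rfl⟩

/-- The certificate for the four-cycle `0, 1, 2, 3` with the cut edges `{0, 1}` and `{2, 3}`. For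
data with ones on the diagonal, `x` and `y` at the other two edges, and zeros at the cut edges, the
missing entries of a solution can both be a square root of `1 + x * y`; here `x = 2`, `y = 4`. -/
theorem cutCertificate_four : CutCertificate (cycleOn 4)
    !![1, 0, 3, 2; 0, 1, 4, 3; 3, 4, 1, 0; 2, 3, 0, 1]
    !![2/3, -1/2, 0, 1/6; -1/2, 1/3, 1/6, 0; 0, 1/6, 1/3, -1/2; 1/6, 0, -1/2, 2/3]
    {a | a.val = 1 ∨ a.val = 2} where
  symm := by
    ext i j
    fin_cases i <;> fin_cases j <;> rfl
  mem := by
    refine ⟨?_, fun i j hij h => ?_⟩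
    · ext i j
      fin_cases i <;> fin_cases j <;> rfl
    · fin_cases i <;> fin_cases j <;> simp [cycleOn] at hij h ⊢
  mul_eq_one := by
    ext i j
    fin_cases i <;> fin_cases j <;> simp [Matrix.mul_apply, Fin.sum_univ_four] <;> norm_num
  cut := by
    intro i j h hi hj
    fin_cases i <;> fin_cases j <;> simp [cycleOn] at h hi hj ⊢
  exists_ne := ⟨1, 0, by simp, by simp, by norm_num⟩
  nondegenerate := by
    rintro X ⟨hX, hX0⟩ hT
    have e02 : X 0 2 = 0 := hX0 0 2 (by decide) (by simp [cycleOn])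
    have e13 : X 1 3 = 0 := hX0 1 3 (by decide) (by simp [cycleOn])
    have t00 := hT 0 0 (Or.inl rfl)
    have t11 := hT 1 1 (Or.inl rfl)
    have t22 := hT 2 2 (Or.inl rfl)
    have t33 := hT 3 3 (Or.inl rfl)
    have t01 := hT 0 1 (Or.inr (by simp [cycleOn]))
    have t12 := hT 1 2 (Or.inr (by simp [cycleOn]))
    have t23 := hT 2 3 (Or.inr (by simp [cycleOn]))
    have t03 := hT 0 3 (Or.inr (by simp [cycleOn]))
    have s01 := hX.apply 0 1
    have s02 := hX.apply 0 2
    have s03 := hX.apply 0 3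
    have s12 := hX.apply 1 2
    have s13 := hX.apply 1 3
    have s23 := hX.apply 2 3
    simp only [Matrix.mul_apply, Fin.sum_univ_four] at t00 t11 t22 t33 t01 t12 t23 t03
    simp [s01, s02, s03, s12, s13, s23, e02, e13] at t00 t11 t22 t33 t01 t12 t23 t03
    have z00 : X 0 0 = 0 := by linarith
    have z11 : X 1 1 = 0 := by linarith
    have z22 : X 2 2 = 0 := by linarith
    have z33 : X 3 3 = 0 := by linarith
    have z01 : X 0 1 = 0 := by linarith
    have z12 : X 1 2 = 0 := by linarith
    have z23 : X 2 3 = 0 := by linarith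
    have z03 : X 0 3 = 0 := by linarith
    ext i j
    fin_cases i <;> fin_cases j <;> simp [*]
  nonsingularOn := by
    intro s x hx hT
    have h : ∀ i, (i ∉ s ∧ x i = 0) ∨ (i ∈ s ∧
        (!![1, 0, 3, 2; 0, 1, 4, 3; 3, 4, 1, 0; 2, 3, 0, 1] *ᵥ x) i = 0) := by
      intro i
      by_cases hi : i ∈ s
      · exact Or.inr ⟨hi, hT i hi⟩
      · exact Or.inl ⟨hi, hx i hi⟩
    have h0 := (h 0).imp And.right And.right
    have h1 := (h 1).imp And.right And.right
    have h2 := (h 2).imp And.right And.right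
    have h3 := (h 3).imp And.right And.right
    simp [mulVec, dotProduct, Fin.sum_univ_four] at h0 h1 h2 h3
    have : x 0 = 0 ∧ x 1 = 0 ∧ x 2 = 0 ∧ x 3 = 0 := by
      rcases h0 with h0 | h0 <;> rcases h1 with h1 | h1 <;> rcases h2 with h2 | h2 <;>
        rcases h3 with h3 | h3 <;> refine ⟨?_, ?_, ?_, ?_⟩ <;> linarith
    ext i
    fin_cases i <;> simp [this]

/-! ### Subdivision of an edge -/

section Subdivision

variable {V : Type*} [DecidableEq V]

/-- The vector with entries `a` at `p` and `b` at `q`. -/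
def pairVec (p q : V) (a b : ℝ) : V → ℝ := Pi.single p a + Pi.single q b

variable {p q r : V} {a b : ℝ}

theorem pairVec_left (hpq : p ≠ q) : pairVec p q a b p = a := by simp [pairVec, hpq]

theorem pairVec_right (hpq : p ≠ q) : pairVec p q a b q = b := by simp [pairVec, hpq.symm]

theorem pairVec_of_ne {i : V} (hp : i ≠ p) (hq : i ≠ q) : pairVec p q a b i = 0 := by
  simp [pairVec, hp, hq]

variable [Fintype V]

theorem pairVec_dotProduct (p q : V) (a b : ℝ) (w : V → ℝ) :
    pairVec p q a b ⬝ᵥ w = a * w p + b * w q := by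
  simp [pairVec, add_dotProduct]

theorem mulVec_pairVec (M : Matrix V V ℝ) (p q : V) (a b : ℝ) (i : V) :
    (M *ᵥ pairVec p q a b) i = a * M i p + b * M i q := by
  rw [← pairVec_dotProduct p q a b (M i), dotProduct_comm]
  rfl

/-- For each `s` the principal submatrix at `s` remains nonsingular after the shear with
coefficients `a` and `b`, unless a nontrivial polynomial in `a` and `b` vanishes. Its coefficients
come from the Schur complement of the principal submatrix at `s \ {r}`. -/
theorem shear_pairVec_nonsingularOn {T : Matrix V V ℝ} (hTs : T.IsSymm)
    (hT : ∀ s : Set V, T.NonsingularOn s) (hr : ∀ j, T r j = if r = j then 1 else 0)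
    (hpr : p ≠ r) (hqr : q ≠ r) (κ : ℝ) (s : Set V) :
    ∃ α β γ : ℝ, (α ≠ 0 ∨ β ≠ 0) ∧ ∀ a b, a * b = κ → α * a ^ 2 + β + γ * b ^ 2 ≠ 0 →
      (shear r (-pairVec p q a b) * T * (shear r (-pairVec p q a b))ᵀ).NonsingularOn s := by
  have hmul : ∀ a b x, (shear r (-pairVec p q a b) * T * (shear r (-pairVec p q a b))ᵀ) *ᵥ x =
      shear r (-pairVec p q a b) *ᵥ (T *ᵥ ((shear r (-pairVec p q a b))ᵀ *ᵥ x)) := by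
    intro a b x
    rw [mulVec_mulVec, mulVec_mulVec, Matrix.mul_assoc]
  have hcol : ∀ i, T i r = if i = r then 1 else 0 := by
    intro i
    rw [← hTs.apply, hr]
    simp only [eq_comm]
  by_cases hrs : r ∈ s
  · obtain ⟨c, hc0, hc⟩ := (hT (s \ {r})).exists_solution fun i => T i p
    obtain ⟨d, hd0, hd⟩ := (hT (s \ {r})).exists_solution fun i => T i q
    have hcr : c r = 0 := hc0 r (by simp)
    have hdr : d r = 0 := hd0 r (by simp)
    let C : V → ℝ := T *ᵥ (Pi.single p 1 - c)
    let D : V → ℝ := T *ᵥ (Pi.single q 1 - d)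
    have hTr : ∀ x : V → ℝ, (T *ᵥ x) r = x r := by
      intro x
      simp [mulVec, dotProduct, hr]
    have hC : ∀ i ∈ s \ {r}, C i = 0 := by
      intro i hi
      simp only [C, mulVec_sub, Pi.sub_apply, hc i hi, mulVec_single_one, col_apply, sub_self]
    have hD : ∀ i ∈ s \ {r}, D i = 0 := by
      intro i hi
      simp only [D, mulVec_sub, Pi.sub_apply, hd i hi, mulVec_single_one, col_apply, sub_self]
    refine ⟨C p, 1 + κ * (C q + D p), D q, ?_, ?_⟩
    · by_cases hps : p ∈ s
      · -- the vector `c` is the unit vector at `p`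
        right
        have hzero : Pi.single p 1 - c = 0 := by
          refine hT (s \ {r}) _ (fun i hi => ?_) hC
          have hip : i ≠ p := by
            rintro rfl
            exact hi ⟨hps, hpr⟩
          simp [hip, hc0 i hi]
        have h1 : C q = 0 := by simp only [C, hzero, mulVec_zero, Pi.zero_apply]
        rw [h1, hD p ⟨hps, hpr⟩]
        simp
      · left
        intro hCp
        have hzero : Pi.single p 1 - c = 0 := by
          refine hT (insert p (s \ {r})) _ (fun i hi => ?_) ?_
          · rw [Set.mem_insert_iff, not_or] at hi
            simp [hi.1, hc0 i hi.2]
          · rintro i (rfl | hi)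
            · exact hCp
            · exact hC i hi
        have := congrFun hzero p
        simp [hc0 p fun h => hps h.1] at this
    · intro a b hab hne x hx hTx
      set y : V → ℝ := (shear r (-pairVec p q a b))ᵀ *ᵥ x with hy
      have hyi : ∀ i, y i = x i - x r * pairVec p q a b i := by
        intro i
        rw [hy, shear_transpose_mulVec_apply, Pi.neg_apply]
        ring
      have hur : pairVec p q a b r = 0 := pairVec_of_ne hpr.symm hqr.symm
      have hyr : y r = x r := by rw [hyi, hur, mul_zero, sub_zero]
      have h1 : ∀ i ∈ s \ {r}, (T *ᵥ y) i = 0 := by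
        intro i hi
        have hir : i ≠ r := hi.2
        have := hTx i hi.1
        rwa [hmul, shear_mulVec_apply, if_neg hir, add_zero] at this
      have h2 : x r = a * (T *ᵥ y) p + b * (T *ᵥ y) q := by
        have := hTx r hrs
        rw [hmul, shear_mulVec_apply, if_pos rfl, neg_dotProduct, pairVec_dotProduct, hTr, ← hy,
          hyr] at this
        linarith
      -- `y` is a combination of the unit vector at `r` and of the two corrected unit vectors
      have h3 : y = x r • (Pi.single r 1 - a • (Pi.single p 1 - c) - b • (Pi.single q 1 - d)) := by
        rw [← sub_eq_zero]
        refine hT (s \ {r}) _ (fun i hi => ?_) fun i hi => ?_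
        · rcases eq_or_ne i r with rfl | hir
          · simp [hyr, hpr.symm, hqr.symm, hcr, hdr]
          · have his : i ∉ s := fun h => hi ⟨h, hir⟩
            have hpv : pairVec p q a b i = a * (Pi.single p 1 : V → ℝ) i +
                b * (Pi.single q 1 : V → ℝ) i := by
              simp [pairVec, Pi.single_apply]
            simp only [Pi.sub_apply, Pi.smul_apply, smul_eq_mul, hyi, hx i his, hc0 i hi, hd0 i hi,
              Pi.single_eq_of_ne hir, hpv]
            ring
        · have e1 : (T *ᵥ Pi.single r 1) i = 0 := by
            have hir : i ≠ r := hi.2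
            rw [mulVec_single_one, col_apply, hcol, if_neg hir]
          have e2 : (T *ᵥ (Pi.single p 1 - c)) i = 0 := hC i hi
          have e3 : (T *ᵥ (Pi.single q 1 - d)) i = 0 := hD i hi
          rw [mulVec_sub, Pi.sub_apply, h1 i hi, mulVec_smul, Pi.smul_apply, mulVec_sub,
            mulVec_sub, mulVec_smul, mulVec_smul, Pi.sub_apply, Pi.sub_apply, Pi.smul_apply,
            Pi.smul_apply, e1, e2, e3]
          simp
      have h4 : ∀ i, i ≠ r → (T *ᵥ y) i = -(x r * (a * C i + b * D i)) := by
        intro i hi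
        have e1 : (T *ᵥ Pi.single r 1) i = 0 := by
          rw [mulVec_single_one, col_apply, hcol, if_neg hi]
        rw [h3, mulVec_smul, Pi.smul_apply, mulVec_sub, mulVec_sub, mulVec_smul, mulVec_smul,
          Pi.sub_apply, Pi.sub_apply, Pi.smul_apply, Pi.smul_apply, e1]
        simp only [smul_eq_mul, C, D]
        ring
      have h5 : x r = 0 := by
        rw [h4 p hpr, h4 q hqr] at h2
        have h6 : x r * (C p * a ^ 2 + (1 + κ * (C q + D p)) + D q * b ^ 2) = 0 := by
          rw [← hab]
          linear_combination h2
        exact (mul_eq_zero.1 h6).resolve_right hne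
      rw [h5, zero_smul] at h3
      funext i
      have := hyi i
      rw [h3, h5] at this
      simpa using this.symm
  · refine ⟨0, 1, 0, Or.inr one_ne_zero, fun a b _ _ x hx hTx => hT s x hx fun i hi => ?_⟩
    have hy : (shear r (-pairVec p q a b))ᵀ *ᵥ x = x := by
      funext j
      rw [shear_transpose_mulVec_apply, hx r hrs, mul_zero, add_zero]
    have := hTx i hi
    rw [hmul, hy, shear_mulVec_apply, if_neg, add_zero] at this
    · exact this
    · rintro rfl
      exact hrs hi

/-- At a nondegenerate solution the linearized equations with an arbitrary right-hand side at the
edge `{p, q}`, and zero elsewhere, have at most one solution up to scaling. -/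
theorem EdgeNondegenerate.exists_coefficient {H : SimpleGraph V} {T : Matrix V V ℝ}
    (hT : EdgeNondegenerate H T) (hTs : T.IsSymm) (p q : V) :
    ∃ c : ℝ, ∀ Z ∈ realConcentrationSpace H,
      (∀ i j, (i = j ∨ H.Adj i j) → ¬ (i = p ∧ j = q) → ¬ (i = q ∧ j = p) → (T * Z * T) i j = 0) →
      Z p q = c * (T * Z * T) p q ∧ ((T * Z * T) p q = 0 → Z = 0) := by
  have hsymm : ∀ Z ∈ realConcentrationSpace H, (T * Z * T).IsSymm := by
    intro Z hZ
    have := IsSymm.congr hZ.1 T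
    rwa [hTs.eq] at this
  have hzero : ∀ Z ∈ realConcentrationSpace H,
      (∀ i j, (i = j ∨ H.Adj i j) → ¬ (i = p ∧ j = q) → ¬ (i = q ∧ j = p) → (T * Z * T) i j = 0) →
      (T * Z * T) p q = 0 → Z = 0 := by
    intro Z hZ h h0
    refine hT Z hZ fun i j hij => ?_
    by_cases h1 : i = p ∧ j = q
    · rw [h1.1, h1.2, h0]
    by_cases h2 : i = q ∧ j = p
    · rw [h2.1, h2.2, (hsymm Z hZ).apply, h0]
    exact h i j hij h1 h2
  by_cases hex : ∃ Z ∈ realConcentrationSpace H,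
      (∀ i j, (i = j ∨ H.Adj i j) → ¬ (i = p ∧ j = q) → ¬ (i = q ∧ j = p) → (T * Z * T) i j = 0) ∧
      (T * Z * T) p q ≠ 0
  · obtain ⟨W, hW, hW0, hWne⟩ := hex
    refine ⟨W p q / (T * W * T) p q, fun Z hZ hZ0 => ⟨?_, hzero Z hZ hZ0⟩⟩
    set t : ℝ := (T * Z * T) p q / (T * W * T) p q with ht
    have hlin : T * (Z - t • W) * T = T * Z * T - t • (T * W * T) := by
      rw [Matrix.mul_sub, Matrix.sub_mul, Matrix.mul_smul, Matrix.smul_mul]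
    have h := hzero (Z - t • W) (Submodule.sub_mem _ hZ (Submodule.smul_mem _ _ hW))
      (fun i j hij h1 h2 => by
        rw [hlin, Matrix.sub_apply, Matrix.smul_apply, hZ0 i j hij h1 h2, hW0 i j hij h1 h2]
        simp)
      (by
        rw [hlin, Matrix.sub_apply, Matrix.smul_apply, smul_eq_mul, ht, div_mul_cancel₀ _ hWne,
          sub_self])
    have h' := congrFun (congrFun h p) q
    rw [Matrix.sub_apply, Matrix.smul_apply, smul_eq_mul, Matrix.zero_apply, sub_eq_zero] at h'
    rw [h', ht]
    ring
  · push Not at hex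
    refine ⟨0, fun Z hZ hZ0 => ?_⟩
    have h0 := hex Z hZ fun i j hij h1 h2 =>
      hZ0 i j hij (fun h => h1 h.1 h.2) fun h => h2 h.1 h.2
    have hZ' := hzero Z hZ hZ0 h0
    subst hZ'
    simp

/-- The graph `H'` arises from `H` by putting the vertex `r`, isolated in `H`, on the edge
`{p, q}`. -/
structure IsSubdivision (H H' : SimpleGraph V) (p q r : V) : Prop where
  adj : H.Adj p q
  isolated : ∀ j, ¬ H.Adj r j
  ne_left : p ≠ r
  ne_right : q ≠ r
  adj_iff : ∀ i j, H'.Adj i j ↔ (H.Adj i j ∧ ¬ (i = p ∧ j = q) ∧ ¬ (i = q ∧ j = p)) ∨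
    (i = r ∧ (j = p ∨ j = q)) ∨ (j = r ∧ (i = p ∨ i = q))

/-- The linearized equations after the subdivision reduce to those before it, with an unknown
right-hand side `τ` at the subdivided edge. The remaining equations determine the other unknowns
in terms of `τ`, and leave one equation that is `τ` times a polynomial in `a` and `b`. -/
theorem IsSubdivision.edgeNondegenerate {H H' : SimpleGraph V} (h : IsSubdivision H H' p q r)
    {T : Matrix V V ℝ} (hT : EdgeNondegenerate H T) (hTs : T.IsSymm)
    (hdet : T p p * T q q - T p q ^ 2 ≠ 0)
    (hr : ∀ j, T r j = if r = j then 1 else 0) (κ : ℝ) :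
    ∃ β : ℝ, ∀ a b, a * b = κ → T p p * a ^ 2 + β + T q q * b ^ 2 ≠ 0 →
      EdgeNondegenerate H'
        (shear r (-pairVec p q a b) * T * (shear r (-pairVec p q a b))ᵀ) := by
  obtain ⟨c, hc⟩ := hT.exists_coefficient hTs p q
  refine ⟨(c + 2 * κ ^ 2) * (T p p * T q q - T p q ^ 2) - 2 * κ * T p q,
    fun a b hab hne X hX hTX => ?_⟩
  have hpq : p ≠ q := h.adj.ne
  have hpr := h.ne_left
  have hqr := h.ne_right
  have hcol : ∀ i, T i r = if i = r then 1 else 0 := by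
    intro i
    rw [← hTs.apply, hr]
    simp only [eq_comm]
  set u := pairVec p q a b with hu
  have hup : u p = a := pairVec_left hpq
  have huq : u q = b := pairVec_right hpq
  have hu0 : ∀ i, i ≠ p → i ≠ q → u i = 0 := fun i => pairVec_of_ne
  have hur : u r = 0 := hu0 r hpr.symm hqr.symm
  set Q := shear r (-u) with hQ
  set Y := Qᵀ * X * Q with hY
  have hYs : Y.IsSymm := by simpa [hY] using IsSymm.congr hX.1 Qᵀ
  have hYap : ∀ i j, Y i j = X i j - u i * X r j - X i r * u j + u i * u j * X r r := by
    intro i j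
    rw [hY, hQ, shear_transpose_congr_apply, Pi.neg_apply, Pi.neg_apply]
    ring
  set M := T * Y * T with hM
  have hMs : M.IsSymm := by
    have := IsSymm.congr hYs T
    rwa [hTs.eq] at this
  have hMQ : Q * T * Qᵀ * X * (Q * T * Qᵀ) = Q * M * Qᵀ := by
    simp only [hM, hY, Matrix.mul_assoc]
  rw [hMQ] at hTX
  have hMu : ∀ i, (M *ᵥ u) i = a * M i p + b * M i q := fun i => mulVec_pairVec M p q a b i
  have hE : ∀ i j, (i = j ∨ H'.Adj i j) → M i j + (if i = r then -(a * M j p + b * M j q) else 0) +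
      (if j = r then -(a * M i p + b * M i q) else 0) +
      (if i = r ∧ j = r then a * (a * M p p + b * M p q) + b * (a * M q p + b * M q q) else 0)
        = 0 := by
    intro i j hij
    refine Eq.trans ?_ (hTX i j hij)
    rw [hQ, shear_congr_apply hMs]
    simp only [mulVec_neg, Pi.neg_apply, hMu, neg_dotProduct, dotProduct_neg, neg_neg]
    rw [hu, pairVec_dotProduct, ← hu, hMu, hMu]
  -- the entries of `M` in the row `r`
  have hX0 : ∀ j, j ≠ r → j ≠ p → j ≠ q → X r j = 0 := by
    intro j hj hp hq
    refine hX.2 r j hj.symm ?_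
    rw [h.adj_iff]
    rintro (h' | h' | h')
    · exact h.isolated j h'.1
    · exact h'.2.elim hp hq
    · exact hj h'.1
  have hYr : ∀ j, Y r j = X r j - X r r * u j := by
    intro j
    rw [hYap, hur]
    ring
  have hMr : ∀ j, M r j = ∑ l, Y r l * T l j := by
    intro j
    rw [hM, Matrix.mul_apply]
    refine Finset.sum_congr rfl fun l _ => ?_
    rw [Matrix.mul_apply]
    simp [hr]
  have hMrj : ∀ j, j ≠ r → M r j = Y r p * T p j + Y r q * T q j := by
    intro j hj
    rw [hMr, Fintype.sum_eq_add p q hpq]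
    rintro l ⟨hlp, hlq⟩
    rcases eq_or_ne l r with rfl | hlr
    · rw [hr, if_neg hj.symm, mul_zero]
    · rw [hYr, hX0 l hlr hlp hlq, hu0 l hlp hlq, mul_zero, sub_zero, zero_mul]
  have hMrr : M r r = X r r := by
    rw [hMr, Fintype.sum_eq_single r]
    · rw [hr, if_pos rfl, hYr, hur]
      ring
    · intro l hl
      rw [hcol, if_neg hl, mul_zero]
  -- the equations at the new vertex
  set τ := M p q with hτ
  have hMpp : M p p = 0 := by simpa [hpr] using hE p p (Or.inl rfl)
  have hMqq : M q q = 0 := by simpa [hqr] using hE q q (Or.inl rfl)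
  have hMqp : M q p = τ := hMs.apply p q
  have hrp : Y r p * T p p + Y r q * T q p = b * τ := by
    have := hE r p (Or.inr ((h.adj_iff _ _).2 (Or.inr (Or.inl ⟨rfl, Or.inl rfl⟩))))
    rw [hMrj p hpr, hMpp] at this
    simp only [if_true, hpr, if_false, and_false] at this
    linarith
  have hrq : Y r p * T p q + Y r q * T q q = a * τ := by
    have := hE r q (Or.inr ((h.adj_iff _ _).2 (Or.inr (Or.inl ⟨rfl, Or.inr rfl⟩))))
    rw [hMrj q hqr, hMqq, hMqp] at this
    simp only [if_true, hqr, if_false, and_false] at this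
    linarith
  have hrr : X r r = 2 * κ * τ := by
    have := hE r r (Or.inl rfl)
    simp only [if_true, and_self] at this
    rw [hMrr, hMrj p hpr, hMrj q hqr, hMpp, hMqq, hMqp, hrp, hrq] at this
    rw [← hab]
    linear_combination this
  -- the part of `Y` outside `r` solves the linearized equations for `H`
  let Z : Matrix V V ℝ := of fun i j => if i = r ∨ j = r then 0 else Y i j
  have hZmem : Z ∈ realConcentrationSpace H := by
    refine ⟨?_, fun i j hij hadj => ?_⟩
    · ext i j
      simp only [Z, transpose_apply, of_apply, hYs.apply, or_comm]
    · by_cases hi : i = r ∨ j = r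
      · simp only [Z, of_apply, if_pos hi]
      · simp only [Z, of_apply, if_neg hi]
        rw [not_or] at hi
        have hn : ¬ (i = p ∧ j = q) ∧ ¬ (i = q ∧ j = p) := by
          constructor
          · rintro ⟨rfl, rfl⟩
            exact hadj h.adj
          · rintro ⟨rfl, rfl⟩
            exact hadj h.adj.symm
        have e0 : X i j = 0 := by
          refine hX.2 i j hij ?_
          rw [h.adj_iff]
          rintro (h' | h' | h')
          · exact hadj h'.1
          · exact hi.1 h'.1
          · exact hi.2 h'.1
        have e1 : u i = 0 ∨ (u j = 0 ∧ X r j = 0) := by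
          by_cases hip : i = p
          · right
            have hjq : j ≠ q := fun h' => hn.1 ⟨hip, h'⟩
            have hjp : j ≠ p := fun h' => hij (hip.trans h'.symm)
            exact ⟨hu0 j hjp hjq, hX0 j hi.2 hjp hjq⟩
          by_cases hiq : i = q
          · right
            have hjp : j ≠ p := fun h' => hn.2 ⟨hiq, h'⟩
            have hjq : j ≠ q := fun h' => hij (hiq.trans h'.symm)
            exact ⟨hu0 j hjp hjq, hX0 j hi.2 hjp hjq⟩
          exact Or.inl (hu0 i hip hiq)
        have e2 : u j = 0 ∨ (u i = 0 ∧ X i r = 0) := by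
          by_cases hjp : j = p
          · right
            have hiq : i ≠ q := fun h' => hn.2 ⟨h', hjp⟩
            have hip : i ≠ p := fun h' => hij (h'.trans hjp.symm)
            exact ⟨hu0 i hip hiq, by rw [← hX.1.apply, hX0 i hi.1 hip hiq]⟩
          by_cases hjq : j = q
          · right
            have hip : i ≠ p := fun h' => hn.1 ⟨h', hjq⟩
            have hiq : i ≠ q := fun h' => hij (h'.trans hjq.symm)
            exact ⟨hu0 i hip hiq, by rw [← hX.1.apply, hX0 i hi.1 hip hiq]⟩
          exact Or.inl (hu0 j hjp hjq)
        have e3 : u i * X r j = 0 := by rcases e1 with e | e <;> simp [e]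
        have e4 : X i r * u j = 0 := by rcases e2 with e | e <;> simp [e]
        have e5 : u i * u j = 0 := by rcases e1 with e | e <;> simp [e]
        rw [hYap, e0, e3, e4, e5]
        ring
  have hTZ : ∀ i j, i ≠ r → j ≠ r → (T * Z * T) i j = M i j := by
    intro i j hi hj
    rw [hM, Matrix.mul_apply, Matrix.mul_apply]
    refine Finset.sum_congr rfl fun l _ => ?_
    rcases eq_or_ne l r with rfl | hl
    · rw [hr, if_neg hj.symm, mul_zero, mul_zero]
    congr 1
    rw [Matrix.mul_apply, Matrix.mul_apply]
    refine Finset.sum_congr rfl fun k _ => ?_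
    rcases eq_or_ne k r with rfl | hk
    · rw [hcol, if_neg hi, zero_mul, zero_mul]
    · simp only [Z, of_apply, hk, hl, or_self, if_false]
  have hTZr : (T * Z * T) r r = 0 := by
    rw [Matrix.mul_apply]
    refine Finset.sum_eq_zero fun l _ => ?_
    have : (T * Z) r l = 0 := by
      rw [Matrix.mul_apply]
      refine Finset.sum_eq_zero fun k _ => ?_
      rw [hr]
      by_cases hk : r = k
      · simp [Z, hk]
      · simp [hk]
    rw [this, zero_mul]
  obtain ⟨hZpq, hZ0⟩ := hc Z hZmem fun i j hij h1 h2 => by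
    by_cases hi : i = r
    · rcases hij with rfl | hij
      · rw [hi, hTZr]
      · exact absurd (hi ▸ hij) (h.isolated j)
    by_cases hj : j = r
    · rcases hij with rfl | hij
      · exact absurd hj hi
      · exact absurd (hj ▸ hij.symm) (h.isolated i)
    rw [hTZ i j hi hj]
    have hij' : i = j ∨ H'.Adj i j :=
      hij.imp id fun h' => (h.adj_iff i j).2 (Or.inl ⟨h', h1, h2⟩)
    simpa [hi, hj] using hE i j hij'
  rw [hTZ p q hpr hqr] at hZpq hZ0
  -- the equation for `τ`
  have hXpq : X p q = 0 := by
    refine hX.2 p q hpq ?_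
    rw [h.adj_iff]
    rintro (h' | h' | h')
    · exact h'.2.1 ⟨rfl, rfl⟩
    · exact hpr h'.1
    · exact hqr h'.1
  have hYpq : Z p q = -(a * Y r q) - b * Y r p - κ * X r r := by
    have e : Z p q = Y p q := by simp only [Z, of_apply, hpr, hqr, or_self, if_false]
    rw [e, hYap, hXpq, hup, huq, hYr, hYr, hup, huq, ← hX.1.apply r p, ← hab]
    ring
  have hTqp : T q p = T p q := hTs.apply p q
  rw [hTqp] at hrp
  have hτ0 : τ = 0 := by
    have hkey : τ * (T p p * a ^ 2 + ((c + 2 * κ ^ 2) * (T p p * T q q - T p q ^ 2) -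
        2 * κ * T p q) + T q q * b ^ 2) = 0 := by
      have e1 : c * τ = -(a * Y r q) - b * Y r p - κ * (2 * κ * τ) := by
        rw [← hZpq, hYpq, hrr]
      have e2 : Y r p * (T p p * T q q - T p q ^ 2) = τ * (b * T q q - a * T p q) := by
        linear_combination T q q * hrp - T p q * hrq
      have e3 : Y r q * (T p p * T q q - T p q ^ 2) = τ * (a * T p p - b * T p q) := by
        linear_combination T p p * hrq - T p q * hrp
      linear_combination (T p p * T q q - T p q ^ 2) * e1 - b * e2 - a * e3 +
        2 * τ * T p q * hab
    exact (mul_eq_zero.1 hkey).resolve_right hne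
  have hZz := hZ0 hτ0
  rw [hτ0, mul_zero] at hrp hrq hrr
  have hYrp : Y r p = 0 := by
    have : Y r p * (T p p * T q q - T p q ^ 2) = 0 := by
      linear_combination T q q * hrp - T p q * hrq
    exact (mul_eq_zero.1 this).resolve_right hdet
  have hYrq : Y r q = 0 := by
    have : Y r q * (T p p * T q q - T p q ^ 2) = 0 := by
      linear_combination T p p * hrq - T p q * hrp
    exact (mul_eq_zero.1 this).resolve_right hdet
  have hXr : ∀ j, X r j = 0 := by
    intro j
    by_cases hj : j = r
    · rw [hj, hrr]
    by_cases hp : j = p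
    · have := hYr p
      rw [hYrp, hrr] at this
      rw [hp]
      linarith
    by_cases hq : j = q
    · have := hYr q
      rw [hYrq, hrr] at this
      rw [hq]
      linarith
    exact hX0 j hj hp hq
  ext i j
  rw [Matrix.zero_apply]
  by_cases hi : i = r
  · rw [hi, hXr]
  by_cases hj : j = r
  · rw [hj, ← hX.1.apply, hXr]
  have e : Y i j = 0 := by
    have := congrFun (congrFun hZz i) j
    simpa [Z, hi, hj] using this
  have hXc : X i r = 0 := (hX.1.apply r i).trans (hXr i)
  rw [hYap, hXr, hXr, hXc] at e
  linarith

/-- A nontrivial Laurent polynomial `α t² + β + γ (κ / t)²` vanishes at finitely many points. -/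
theorem eventually_laurent_ne_zero {α β γ κ : ℝ} (h : α ≠ 0 ∨ β ≠ 0) :
    ∀ᶠ t : ℝ in atTop, α * t ^ 2 + β + γ * (κ / t) ^ 2 ≠ 0 := by
  obtain ⟨δ, hδ⟩ : ∃ δ, δ = γ * κ ^ 2 := ⟨_, rfl⟩
  let P : Polynomial ℝ := Polynomial.C α * Polynomial.X ^ 4 + Polynomial.C β * Polynomial.X ^ 2 +
    Polynomial.C δ
  have hP : P ≠ 0 := by
    intro h0
    have h4 := congrArg (fun R => Polynomial.coeff R 4) h0
    have h2 := congrArg (fun R => Polynomial.coeff R 2) h0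
    simp [P, Polynomial.coeff_X_pow] at h4 h2
    exact h.elim (fun h => h h4) fun h => h h2
  have hfin : {t | P.IsRoot t}.Finite := Polynomial.finite_setOfPred_isRoot hP
  filter_upwards [atTop_le_cofinite hfin.compl_mem_cofinite, eventually_gt_atTop 0] with t ht ht0 h0
  refine ht ?_
  have : P.eval t = t ^ 2 * (α * t ^ 2 + β + γ * (κ / t) ^ 2) := by
    simp only [P, Polynomial.eval_add, Polynomial.eval_mul, Polynomial.eval_C, Polynomial.eval_pow,
      Polynomial.eval_X, hδ]
    field_simp
  exact this.trans (by rw [h0, mul_zero])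

/-- Certificates pass to subdivisions of edges that are not cut: the shear with coefficients
`a = t` and `b = -K p q / t` leaves the solution unchanged outside the new vertex `r` and cancels
the entry of the inverse at `{p, q}`, and all but finitely many `t` preserve nondegeneracy. -/
theorem CutCertificate.subdivide {H H' : SimpleGraph V} (h : IsSubdivision H H' p q r)
    {T K : Matrix V V ℝ} {B : Set V} (hc : CutCertificate H T K B)
    (hT : ∀ j, T r j = if r = j then 1 else 0) (hK : ∀ j, K r j = if r = j then 1 else 0)
    (hp : p ∉ B) (hq : q ∉ B) (hrB : r ∉ B) : ∃ T' K', CutCertificate H' T' K' B := by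
  have hpq : p ≠ q := h.adj.ne
  have hpr := h.ne_left
  have hqr := h.ne_right
  have hKcol : ∀ i, K i r = if i = r then 1 else 0 := by
    intro i
    rw [← hc.mem.1.apply, hK]
    simp only [eq_comm]
  have hTpp : T p p ≠ 0 := by
    intro h0
    have := hc.nonsingularOn {p} (Pi.single p 1) (fun j hj => Pi.single_eq_of_ne hj 1)
      (by simpa using h0)
    simpa using congrFun this p
  have hdet : T p p * T q q - T p q ^ 2 ≠ 0 := by
    intro h0
    have := hc.nonsingularOn {p, q} (pairVec p q (-T p q) (T p p)) (fun j hj => ?_) fun i hi => ?_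
    · have h1 := congrFun this q
      rw [pairVec_right hpq] at h1
      exact hTpp h1
    · simp only [Set.mem_insert_iff, Set.mem_singleton_iff, not_or] at hj
      exact pairVec_of_ne hj.1 hj.2
    · rw [mulVec_pairVec]
      rcases hi with rfl | rfl
      · ring
      · rw [hc.symm.apply p i]
        linear_combination h0
  set κ : ℝ := -K p q with hκ
  choose α β γ hαβ hns using
    fun s => shear_pairVec_nonsingularOn hc.symm hc.nonsingularOn hT hpr hqr κ s
  obtain ⟨β', hnd⟩ := h.edgeNondegenerate hc.nondegenerate hc.symm hdet hT κ
  have hev : ∀ᶠ t : ℝ in atTop, ∀ s : Set V, α s * t ^ 2 + β s + γ s * (κ / t) ^ 2 ≠ 0 :=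
    eventually_all.2 fun s => eventually_laurent_ne_zero (hαβ s)
  obtain ⟨t, ht, ht', ht0⟩ := (hev.and ((eventually_laurent_ne_zero (β := β') (γ := T q q) (κ := κ)
    (Or.inl hTpp)).and (eventually_gt_atTop (0 : ℝ)))).exists
  have hab : t * (κ / t) = κ := mul_div_cancel₀ κ ht0.ne'
  set u := pairVec p q t (κ / t) with hu
  have hup : u p = t := pairVec_left hpq
  have huq : u q = κ / t := pairVec_right hpq
  have hu0 : ∀ i, i ≠ p → i ≠ q → u i = 0 := fun i => pairVec_of_ne
  have hur : u r = 0 := hu0 r hpr.symm hqr.symm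
  have huB : ∀ i ∈ B, u i = 0 := by
    intro i hi
    refine hu0 i ?_ ?_ <;> rintro rfl
    · exact hp hi
    · exact hq hi
  have hK' : ∀ i j, ((shear r u)ᵀ * K * shear r u) i j =
      K i j + u i * K r j + K i r * u j + u i * u j := by
    intro i j
    rw [shear_transpose_congr_apply, hK r, if_pos rfl, mul_one]
  refine ⟨shear r (-u) * T * (shear r (-u))ᵀ, (shear r u)ᵀ * K * shear r u,
    hc.symm.congr _, ⟨by simpa using hc.mem.1.congr (shear r u)ᵀ, fun i j hij hadj => ?_⟩,
    shear_congr_mul_eq_one hur hc.mul_eq_one, fun i j hadj hi hj => ?_, ?_,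
    hnd t (κ / t) hab ht', fun s => hns s t (κ / t) hab (ht s)⟩
  · rw [hK', hK, hKcol]
    rw [h.adj_iff] at hadj
    push Not at hadj
    obtain ⟨h1, h2, h3⟩ := hadj
    by_cases hi : i = r
    · have hj : j ≠ r := fun h' => hij (hi.trans h'.symm)
      rw [hi, hK, if_neg hj.symm, hur, hu0 j (h2 hi).1 (h2 hi).2]
      ring
    by_cases hj : j = r
    · rw [hj, hKcol, if_neg hi, hur, hu0 i (h3 hj).1 (h3 hj).2]
      ring
    rw [if_neg hi, if_neg (Ne.symm hj)]
    by_cases hpq' : i = p ∧ j = q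
    · rw [hpq'.1, hpq'.2, hup, huq, hab]
      ring
    by_cases hqp' : i = q ∧ j = p
    · rw [hqp'.1, hqp'.2, hup, huq, mul_comm (κ / t) t, hab, hc.mem.1.apply p q]
      ring
    have hKij : K i j = 0 := hc.mem.2 i j hij fun hadj =>
      hqp' (h1 hadj fun a b => hpq' ⟨a, b⟩)
    have huu : u i * u j = 0 := by
      by_cases hip : i = p
      · rw [hu0 j (fun h' => hij (hip.trans h'.symm)) fun h' => hpq' ⟨hip, h'⟩, mul_zero]
      by_cases hiq : i = q
      · rw [hu0 j (fun h' => hqp' ⟨hiq, h'⟩) fun h' => hij (hiq.trans h'.symm), mul_zero]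
      rw [hu0 i hip hiq, zero_mul]
    rw [hKij, huu]
    ring
  · have hir : i ≠ r := fun h' => hrB (h' ▸ hi)
    rw [h.adj_iff] at hadj
    have hjr : j ≠ r := by
      intro hjr
      rcases hadj with h' | h' | h'
      · exact h.isolated i (hjr ▸ h'.1.symm)
      · exact hir h'.1
      · rcases h'.2 with rfl | rfl
        · exact hp hi
        · exact hq hi
    rw [shear_congr_apply hc.symm, if_neg hir, if_neg hjr, if_neg fun h' => hir h'.1]
    rcases hadj with h' | h' | h'
    · rw [hc.cut i j h'.1 hi hj]
      ring
    · exact absurd h'.1 hir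
    · exact absurd h'.1 hjr
  · obtain ⟨i, j, hi, hj, hne⟩ := hc.exists_ne
    refine ⟨i, j, hi, hj, ?_⟩
    have hir : i ≠ r := fun h' => hrB (h' ▸ hi)
    rw [hK', huB i hi, hKcol, if_neg hir]
    simpa using hne

end Subdivision

/-! ### Chordless cycles -/

/-- Certificates for all cycles, by repeated subdivision of the edge `{n - 1, 0}`. -/
theorem exists_cutCertificate_cycleOn (n : ℕ) (hn : 4 ≤ n) :
    ∃ T K, CutCertificate (cycleOn n) T K {a | a.val = 1 ∨ a.val = 2} := by
  induction n, hn using Nat.le_induction with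
  | base => exact ⟨_, _, cutCertificate_four⟩
  | succ n hn ih =>
    obtain ⟨T, K, h⟩ := ih
    let H : SimpleGraph (Fin (n + 1)) := (cycleOn n).map Fin.castSuccEmb
    have hf : Function.Injective (Fin.castSuccEmb : Fin n → Fin (n + 1)) :=
      Fin.castSuccEmb.injective
    have hH : ∀ i j, H.Adj i j ↔ i.val < n ∧ j.val < n ∧ i.val ≠ j.val ∧
        (i.val + 1 = j.val ∨ j.val + 1 = i.val ∨ (i.val = 0 ∧ j.val + 1 = n) ∨
          (j.val = 0 ∧ i.val + 1 = n)) := by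
      intro i j
      rw [SimpleGraph.map_adj]
      constructor
      · rintro ⟨a, b, ⟨hab, h'⟩, rfl, rfl⟩
        exact ⟨a.2, b.2, fun h => hab (Fin.ext h), h'⟩
      · rintro ⟨hi, hj, hij, h'⟩
        exact ⟨⟨i, hi⟩, ⟨j, hj⟩, ⟨fun h => hij (Fin.mk.inj_iff.1 h), h'⟩, rfl, rfl⟩
    have hext := h.extend hf (G := H) fun a b => SimpleGraph.map_adj_apply
    have hB : (Fin.castSuccEmb : Fin n → Fin (n + 1)) '' {a | a.val = 1 ∨ a.val = 2} =
        {a | a.val = 1 ∨ a.val = 2} := by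
      ext i
      constructor
      · rintro ⟨a, ha, rfl⟩
        exact ha
      · intro hi
        have hi' : i.val = 1 ∨ i.val = 2 := hi
        exact ⟨⟨i, by omega⟩, hi, rfl⟩
    rw [hB] at hext
    have hlast : Fin.last n ∉ Set.range (Fin.castSuccEmb : Fin n → Fin (n + 1)) := by
      rintro ⟨a, ha⟩
      have h1 : a.val = n := congrArg Fin.val ha
      omega
    refine hext.subdivide (p := ⟨n - 1, by omega⟩) (q := 0) (r := Fin.last n) ?_
      (fun j => extendOne_left T hlast j) (fun j => extendOne_left K hlast j) ?_ ?_ ?_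
    · constructor
      · rw [hH]
        change n - 1 < n ∧ 0 < n ∧ n - 1 ≠ 0 ∧ (n - 1 + 1 = 0 ∨ 0 + 1 = n - 1 ∨
          (n - 1 = 0 ∧ 0 + 1 = n) ∨ (0 = 0 ∧ n - 1 + 1 = n))
        omega
      · intro j
        rw [hH, Fin.val_last]
        omega
      · rw [Ne, Fin.ext_iff, Fin.val_last]
        simp only
        omega
      · rw [Ne, Fin.ext_iff, Fin.val_last, Fin.val_zero]
        omega
      · intro i j
        rw [hH]
        have hi := i.2
        have hj := j.2
        simp only [cycleOn, Fin.ext_iff, Fin.val_last, Fin.val_zero, Ne]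
        omega
    · simp only [Set.mem_ofPred_eq]
      omega
    · simp only [Set.mem_ofPred_eq, Fin.val_zero]
      omega
    · simp only [Set.mem_ofPred_eq, Fin.val_last]
      omega

/-- The vertices of a chordless cycle induce a cycle graph. -/
theorem SimpleGraph.Walk.IsCycle.exists_induced_cycleOn {V : Type*} {G : SimpleGraph V} {v : V}
    {c : G.Walk v v} (hc : c.IsCycle) (hch : c.IsChordless) :
    ∃ f : Fin c.length → V, Function.Injective f ∧
      ∀ a b, G.Adj (f a) (f b) ↔ (cycleOn c.length).Adj a b := by
  have hinj : ∀ i j, i < c.length → j < c.length → c.getVert i = c.getVert j → i = j :=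
    fun i j hi hj hij => hc.getVert_injOn' (by rw [Set.mem_ofPred_eq]; omega)
      (by rw [Set.mem_ofPred_eq]; omega) hij
  have hend : c.getVert c.length = c.getVert 0 := by rw [c.getVert_length, c.getVert_zero]
  refine ⟨fun a => c.getVert a, fun a b hab => Fin.ext (hinj a b a.2 b.2 hab), fun a b => ?_⟩
  have ha := a.2
  have hb := b.2
  constructor
  · intro hadj
    refine ⟨fun h => G.irrefl (h ▸ hadj), ?_⟩
    have hmem := hch.mem_edges (c.getVert_mem_support a) (c.getVert_mem_support b) hadj
    rw [Walk.mk_mem_edges_iff_exists] at hmem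
    obtain ⟨i, hi, he⟩ := hmem
    have hsucc : ∀ k, k < c.length → c.getVert (i + 1) = c.getVert k →
        i + 1 = k ∨ (i + 1 = c.length ∧ k = 0) := by
      intro k hk h
      rcases Nat.lt_or_ge (i + 1) c.length with h' | h'
      · exact Or.inl (hinj _ _ h' hk h)
      · have h1 : i + 1 = c.length := by omega
        rw [h1, hend] at h
        exact Or.inr ⟨h1, (hinj 0 k (by omega) hk h).symm⟩
    rw [Sym2.eq_iff] at he
    rcases he with ⟨h1, h2⟩ | ⟨h1, h2⟩
    · have e1 := hinj _ _ hi ha h1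
      have e2 := hsucc b hb h2
      omega
    · have e1 := hinj _ _ hi hb h1
      have e2 := hsucc a ha h2
      omega
  · have hstep : ∀ i j, i < c.length → (i + 1 = j ∨ (j = 0 ∧ i + 1 = c.length)) →
        G.Adj (c.getVert i) (c.getVert j) := by
      rintro i j hi (rfl | ⟨rfl, h⟩)
      · exact c.adj_getVert_succ hi
      · rw [← hend, ← h]
        exact c.adj_getVert_succ hi
    rintro ⟨-, h | h | h | h⟩
    · exact hstep a b ha (Or.inl h)
    · exact (hstep b a hb (Or.inl h)).symm
    · exact (hstep b a hb (Or.inr h)).symm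
    · exact hstep a b ha (Or.inr h)

theorem theorem4p3 {V : Type*} [Fintype V] [DecidableEq V] (G : SimpleGraph V) :
    G.IsChordalGraph ↔ HasMLDegree G 1 := by
  refine ⟨fun hG => hG.hasMLDegree_one, fun hML => ?_⟩
  intro v c hc hlen hch
  obtain ⟨f, hf, hadj⟩ := hc.exists_induced_cycleOn hch
  obtain ⟨T, K, h⟩ := exists_cutCertificate_cycleOn c.length hlen
  exact (h.extend hf hadj).not_hasMLDegree_one hML
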